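/- **Setting.** Let $G=(V,E,\mu,w)$ be a connected, locally finite weighted graph with $V$ countably infinite, a vertex measure $\mu:V\to(0,\infty)$ with $\inf_V\mu>0$, and symmetric edge weights $w_{xy}=w_{yx}>0$ for $x\sim y$. Write $\int_V g\,d\mu=\sum_{x\in V}g(x)\mu(x)$. Let $p(t,x,y)$ be the heat kernel of $\Delta u(x)=\mu(x)^{-1}\sum_{y\sim x}w_{xy}(u(y)-u(x))$, i.e. the limit, along an exhaustion of $V$ by finite sets $K$, of the Dirichlet heat kernels $p_K(t,x,y)=e^{t\Delta_K}(x,y)/\mu(y)$, and assume that $G$ is stochastically complete: $\sum_{y}p(t,x,y)\mu(y)=1$ for all $t>0$, $x\in V$. Let $s\in(0,1)$ and, for $x\ne y$, $$W_s(x,y)=\frac{s}{\Gamma(1-s)}\mu(x)\mu(y)\int_0^\infty p(t,x,y)\,t^{-1-s}\,dt .$$ For bounded $u,v:V\to\mathbb R$ put $$(-\Delta)^su(x)=\frac1{\mu(x)}\sum_{y\ne x}W_s(x,y)(u(x)-u(y)),\qquad \nabla^su\nabla^sv(x)=\frac1{2\mu(x)}\sum_{y\neq x}W_s(x,y)(u(x)-u(y))(v(x)-v(y)),$$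 and $|\nabla^su|^2=\nabla^su\nabla^su$. Let $h:V\to\mathbb R$ satisfy $\inf_Vh>0$ and, for every fixed $x_0\in V$, $h(x)\to+\infty$ as the combinatorial distance $\mathrm d(x,x_0)\to\infty$. Let $\mathscr H_s$ be the completion of the finitely supported functions on $V$ (realized as a space of bounded functions on $V$) under $$\|u\|_{\mathscr H_s}=\Big(\int_V(|\nabla^su|^2+hu^2)\,d\mu\Big)^{1/2},\qquad\text{and let}\qquad \lambda_1=\inf_{u\in\mathscr H_s,\,u\not\equiv0}\frac{\|u\|_{\mathscr H_s}^2}{\int_Vu^2\,d\mu}.$$ Let $f:V\times\mathbb R\to\mathbb R$ and $F(x,y)=\int_0^yf(x,t)\,dt$, and assume: * (F1) for every $x\in V$, $f(x,\cdot)$ is continuous and $f(x,0)=0$; * (F2) for every $M>0$ there is $C_M$ with $|f(x,y)|\le C_M$ for all $x\in V$, $|y|\le M$; * (F3) there is $\alpha>2$ with $0<\alpha F(x,y)\le yf(x,y)$ for all $x\in V$, $y\ne0$; * (F4) $\limsup_{y\to0}f(x,y)/y<\lambda_1$ uniformly in $x\in V$, i.e. there are $c<\lambda_1$ and $\eta>0$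 with $f(x,y)/y\le c$ for all $x\in V$ and $0<|y|<\eta$; * (F5) for every $x\in V$, $y\mapsto f(x,y)/|y|$ is strictly increasing on $(-\infty,0)$ and on $(0,\infty)$. For $u\in\mathscr H_s$ let $u^+=\max\{u,0\}$, $u^-=\min\{u,0\}$, and $$J_\pm(u)=\frac12\|u\|_{\mathscr H_s}^2-\int_VF(x,u^\pm)\,d\mu,\qquad \mathscr N_\pm=\Big\{u\in\mathscr H_s\setminus\{0\}:\ \|u\|_{\mathscr H_s}^2=\int_Vf(x,u^\pm)u^\pm\,d\mu\Big\}.$$ **Theorem 2.5.** Under these assumptions the equation $$(-\Delta)^su+h(x)u=f(x,u)\quad\text{in }V$$ has at least two ground state solutions in $\mathscr H_s$, one strictly positive and one strictly negative. Precisely, there are $u_+,u_-\in\mathscr H_s$ with $u_+(x)>0$ and $u_-(x)<0$ for all $x\in V$, such that each $u=u_\pm$ satisfies the equation at every $x \in V$ and weakly, i.e. $\int_V(\nabla^su\nabla^s\varphi+hu\varphi)\,d\mu=\int_Vf(x,u)\varphi\,d\mu$ for all $\varphi\in\mathscr H_s$ (all integrals being absolutely convergent), and such that $u_\pm\in\mathscr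 N_\pm$ and $J_\pm(u_\pm)=\min_{\mathscr N_\pm}J_\pm$. -/

import Mathlib

open Filter Topology

noncomputable section

namespace FracGraph

/-- A weighted graph `(V, E, μ, w)`: a simple graph with a positive vertex measure `μ` and a
positive symmetric edge weight `w`, extended by `0` to pairs that are not edges. -/
structure WeightedGraph (V : Type*) where
  graph : SimpleGraph V
  μ : V → ℝ
  μ_pos : ∀ x, 0 < μ x
  w : V → V → ℝ
  w_symm : ∀ x y, w x y = w y x
  w_pos : ∀ x y, graph.Adj x y → 0 < w x y
  w_eq_zero : ∀ x y, ¬ graph.Adj x y → w x y = 0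

variable {V : Type*}

namespace WeightedGraph

/-- Every vertex has finitely many neighbours. -/
def IsLocallyFinite (G : WeightedGraph V) : Prop :=
  ∀ x, (G.graph.neighborSet x).Finite

/-- `∫_V g dμ = ∑_{x ∈ V} g(x) μ(x)`. -/
def integral (G : WeightedGraph V) (g : V → ℝ) : ℝ :=
  ∑' x, g x * G.μ x

/-- The graph Laplacian `Δu(x) = μ(x)⁻¹ ∑_{y ∼ x} w_{xy} (u(y) - u(x))`; on a locally finite graph
the sum is finite. -/
def laplacian (G : WeightedGraph V) (u : V → ℝ) (x : V) : ℝ :=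
  (∑' y, G.w x y * (u y - u x)) / G.μ x

open Classical in
/-- The matrix of the Laplacian on a finite vertex set `K` with Dirichlet condition (functions
that vanish outside `K`): its `(x, y)` entry is `Δδ_y(x)`. -/
def dirichletLaplacian (G : WeightedGraph V) (K : Finset V) : Matrix K K ℝ :=
  Matrix.of fun x y => G.laplacian (fun z => if z = (y : V) then 1 else 0) (x : V)

open Classical in
/-- The Dirichlet heat kernel of the finite set `K`, `p_K(t,x,y) = e^{tΔ_K}(x,y) / μ(y)`, extended
by `0` outside `K × K`. -/
def dirichletHeatKernel (G : WeightedGraph V) (K : Finset V) (t : ℝ) (x y : V) : ℝ :=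
  if hxy : x ∈ K ∧ y ∈ K then
    (NormedSpace.exp (t • G.dirichletLaplacian K)) ⟨x, hxy.1⟩ ⟨y, hxy.2⟩ / G.μ y
  else 0

/-- The (minimal) heat kernel `p(t,x,y)` of the graph. The Dirichlet heat kernels increase with
`K` and are bounded by `1 / μ(y)`, so this supremum is their limit along any exhaustion of `V` by
finite sets. -/
def heatKernel (G : WeightedGraph V) (t : ℝ) (x y : V) : ℝ :=
  ⨆ K : Finset V, G.dirichletHeatKernel K t x y

/-- Stochastic completeness: `∑_y p(t,x,y) μ(y) = 1` for all `t > 0` and all `x`. -/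
def StochasticallyComplete (G : WeightedGraph V) : Prop :=
  ∀ t : ℝ, 0 < t → ∀ x, HasSum (fun y => G.heatKernel t x y * G.μ y) 1

open Classical in
/-- The discrete kernel
`W_s(x,y) = s / Γ(1-s) * μ(x) μ(y) ∫_0^∞ p(t,x,y) t^{-1-s} dt` for `x ≠ y`, and `0` for `x = y`. -/
def kernel (G : WeightedGraph V) (s : ℝ) (x y : V) : ℝ :=
  if x = y then 0
  else s / Real.Gamma (1 - s) * (G.μ x * G.μ y) *
    ∫ t in Set.Ioi (0 : ℝ), G.heatKernel t x y * t ^ (-1 - s)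

/-- The fractional Laplacian `(-Δ)^s u(x) = μ(x)⁻¹ ∑_{y ≠ x} W_s(x,y) (u(x) - u(y))`. -/
def fracLaplacian (G : WeightedGraph V) (s : ℝ) (u : V → ℝ) (x : V) : ℝ :=
  (∑' y, G.kernel s x y * (u x - u y)) / G.μ x

/-- The inner product of the fractional gradients,
`∇^s u ∇^s v (x) = (2 μ(x))⁻¹ ∑_{y ≠ x} W_s(x,y) (u(x) - u(y)) (v(x) - v(y))`. -/
def gradInner (G : WeightedGraph V) (s : ℝ) (u v : V → ℝ) (x : V) : ℝ :=
  (∑' y, G.kernel s x y * ((u x - u y) * (v x - v y))) / (2 * G.μ x)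

/-- `‖u‖² = ∫_V (|∇^s u|² + h u²) dμ`. -/
def normSq (G : WeightedGraph V) (s : ℝ) (h : V → ℝ) (u : V → ℝ) : ℝ :=
  G.integral fun x => G.gradInner s u u x + h x * u x ^ 2

/-- The norm of the space `ℋ_s`. -/
def norm (G : WeightedGraph V) (s : ℝ) (h : V → ℝ) (u : V → ℝ) : ℝ :=
  Real.sqrt (G.normSq s h u)

/-- The bounded functions `u` with `∫_V (|∇^s u|² + h u²) dμ < ∞`. -/
def finiteEnergy (G : WeightedGraph V) (s : ℝ) (h : V → ℝ) : Set (V → ℝ) :=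
  {u | (∃ C, ∀ x, |u x| ≤ C) ∧
    Summable fun x => (G.gradInner s u u x + h x * u x ^ 2) * G.μ x}

/-- The space `ℋ_s`, the completion of `C_c(V)` under `norm`, realized as a space of functions:
the finite energy functions that are limits in norm of finitely supported functions. -/
def Hs (G : WeightedGraph V) (s : ℝ) (h : V → ℝ) : Set (V → ℝ) :=
  {u | u ∈ G.finiteEnergy s h ∧
    ∃ φ : ℕ → V → ℝ, (∀ n, (Function.support (φ n)).Finite) ∧
      Tendsto (fun n => G.norm s h (φ n - u)) atTop (𝓝 0)}

/-- `λ₁ = inf { ‖u‖² / ‖u‖₂² : u ∈ ℋ_s, u ≢ 0 }`, where `‖u‖₂² = ∫_V u² dμ`. -/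
def lambdaOne (G : WeightedGraph V) (s : ℝ) (h : V → ℝ) : ℝ :=
  sInf {r | ∃ u ∈ G.Hs s h, u ≠ 0 ∧ r = G.normSq s h u / G.integral fun x => u x ^ 2}

/-- Weak solutions in `ℋ_s` of `(-Δ)^s u + h u = f(x,u)`:
`∫_V (∇^s u ∇^s φ + h u φ) dμ = ∫_V f(x,u) φ dμ` for all `φ ∈ ℋ_s`, both sides being absolutely
convergent. -/
def IsWeakSolution (G : WeightedGraph V) (s : ℝ) (h : V → ℝ) (f : V → ℝ → ℝ) (u : V → ℝ) : Prop :=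
  u ∈ G.Hs s h ∧ ∀ φ ∈ G.Hs s h,
    (Summable fun x => (G.gradInner s u φ x + h x * u x * φ x) * G.μ x) ∧
    (Summable fun x => f x (u x) * φ x * G.μ x) ∧
    G.integral (fun x => G.gradInner s u φ x + h x * u x * φ x) =
      G.integral fun x => f x (u x) * φ x

/-- Pointwise solutions of `(-Δ)^s u + h u = f(x,u)` in `V`. -/
def IsPointwiseSolution (G : WeightedGraph V) (s : ℝ) (h : V → ℝ) (f : V → ℝ → ℝ)
    (u : V → ℝ) : Prop :=
  ∀ x, G.fracLaplacian s u x + h x * u x = f x (u x)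

end WeightedGraph

/-- The primitive `F(x,y) = ∫_0^y f(x,t) dt`. -/
def primitive (f : V → ℝ → ℝ) (x : V) (y : ℝ) : ℝ :=
  ∫ t in (0 : ℝ)..y, f x t

namespace WeightedGraph

/-- `J₊(u) = ½ ∫_V (|∇^s u|² + h u²) dμ - ∫_V F(x,u⁺) dμ`, with `u⁺ = max {u, 0}`. -/
def energyPos (G : WeightedGraph V) (s : ℝ) (h : V → ℝ) (f : V → ℝ → ℝ) (u : V → ℝ) : ℝ :=
  1 / 2 * G.normSq s h u - G.integral fun x => primitive f x (max (u x) 0)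

/-- `J₋(u) = ½ ∫_V (|∇^s u|² + h u²) dμ - ∫_V F(x,u⁻) dμ`, with `u⁻ = min {u, 0}`. -/
def energyNeg (G : WeightedGraph V) (s : ℝ) (h : V → ℝ) (f : V → ℝ → ℝ) (u : V → ℝ) : ℝ :=
  1 / 2 * G.normSq s h u - G.integral fun x => primitive f x (min (u x) 0)

/-- The Nehari manifold `𝒩₊` of the nonzero `u ∈ ℋ_s` with `‖u‖² = ∫_V f(x,u⁺) u⁺ dμ`. -/
def nehariPos (G : WeightedGraph V) (s : ℝ) (h : V → ℝ) (f : V → ℝ → ℝ) : Set (V → ℝ) :=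
  {u | u ∈ G.Hs s h ∧ u ≠ 0 ∧
    G.normSq s h u = G.integral fun x => f x (max (u x) 0) * max (u x) 0}

/-- The Nehari manifold `𝒩₋` of the nonzero `u ∈ ℋ_s` with `‖u‖² = ∫_V f(x,u⁻) u⁻ dμ`. -/
def nehariNeg (G : WeightedGraph V) (s : ℝ) (h : V → ℝ) (f : V → ℝ → ℝ) : Set (V → ℝ) :=
  {u | u ∈ G.Hs s h ∧ u ≠ 0 ∧
    G.normSq s h u = G.integral fun x => f x (min (u x) 0) * min (u x) 0}

end WeightedGraph

end FracGraph

end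

/-! The energy $\|u\|^2$ is a sum of squares of the coordinates $\sqrt{W_s(x,y)/2}\,(u(x)-u(y))$ and
$\sqrt{h(x)\mu(x)}\,u(x)$, so `energyVec` embeds the finite energy functions isometrically into
$\ell^2$, and $\mathscr H_s$ corresponds to the closure of the span of the images of the point
masses (`mem_Hs_iff`). This rests on finite row sums of $W_s$: stochastic completeness gives
off-diagonal heat mass at most $\min(1,\deg(x)\,t)$, which is integrable against $t^{-1-s}$
(`summable_kernel`).

Since $\inf\mu$ and $\inf h$ are positive, the norm controls the supremum. Norm-bounded sequences
therefore have pointwise convergent subsequences with limit in $\mathscr H_s$, and because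
$h\to\infty$ no mass escapes: $B(u)=\int f(x,u^+)u^+\,d\mu$ and $\int F(x,u^+)\,d\mu$ converge along
them (`tendsto_integral_quadBounded`).

On $\mathscr N_+$, (F3) gives $J_+\ge(\frac12-\frac1\alpha)\|u\|^2$ and (F4) keeps the norm away
from $0$. The limit $v$ of a minimizing sequence $u_n$ satisfies $0<\|v\|^2\le B(v)$, so some $tv$
with $0<t\le1$ lies in $\mathscr N_+$. By (F5) each $u_n$ maximizes $J_+$ on its ray, whence
$J_+(tv)\le\lim J_+(u_n)=\inf J_+$ (`exists_minimizer`).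

Since $f$ is only continuous, $\mathscr N_+$ need not be a $C^1$ manifold and no Lagrange multiplier
is used. Instead $u+\varepsilon\delta_z$ is rescaled back to $\mathscr N_+$ by a factor $t$ near
$1$, and $J_+(tu)\le J_+(u)\le J_+(t(u+\varepsilon\delta_z))$ is compared to first order in
$\varepsilon$ (`sign_mul_nonneg_of_minimizer`). This gives the equation at $z$ with $f(z,u^+)$ on
the right; a minimum principle and connectedness give $u>0$. Density of the point masses yields the
weak form, and the negative solution comes from the nonlinearity $-f(x,-y)$. -/

noncomputable section

namespace FracGraph

/-! ### Exponentials of finite matrices: positivity, row sums, reversibility. -/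

section MatrixExp

variable {n : Type*} [Fintype n] [DecidableEq n]

open scoped Matrix.Norms.Operator in
theorem hasSum_matrix_exp_apply (B : Matrix n n ℝ) (i j : n) :
    HasSum (fun k : ℕ => ((k.factorial : ℝ)⁻¹) * (B ^ k) i j) (NormedSpace.exp B i j) := by
  have h := NormedSpace.exp_series_hasSum_exp' (𝕂 := ℝ) B
  have h2 := (Pi.hasSum.1 (Pi.hasSum.1 h i) j)
  simp only [Matrix.smul_apply, smul_eq_mul] at h2
  exact h2

open scoped Matrix.Norms.Operator in
theorem continuous_matrix_exp_smul_apply (A : Matrix n n ℝ) (i j : n) :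
    Continuous fun t : ℝ => NormedSpace.exp (t • A) i j := by
  have h : Continuous fun t : ℝ => NormedSpace.exp (t • A) :=
    NormedSpace.exp_continuous.comp (continuous_id.smul continuous_const)
  exact (continuous_apply j).comp ((continuous_apply i).comp h)

theorem matrix_pow_nonneg {B : Matrix n n ℝ} (hB : ∀ i j, 0 ≤ B i j) (k : ℕ) (i j : n) :
    0 ≤ (B ^ k) i j := by
  induction k generalizing i j with
  | zero => rw [pow_zero, Matrix.one_apply]; split_ifs <;> norm_num
  | succ k ih =>
    rw [pow_succ, Matrix.mul_apply]
    exact Finset.sum_nonneg fun l _ => mul_nonneg (ih i l) (hB l j)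

theorem one_add_le_matrix_exp {B : Matrix n n ℝ} (hB : ∀ i j, 0 ≤ B i j) (i j : n) :
    (1 : Matrix n n ℝ) i j + B i j ≤ NormedSpace.exp B i j := by
  have h := sum_le_hasSum (Finset.range 2)
    (fun k _ => mul_nonneg (by positivity) (matrix_pow_nonneg hB k i j))
    (hasSum_matrix_exp_apply B i j)
  simpa [Finset.sum_range_succ] using h

theorem sum_matrix_pow_le {B : Matrix n n ℝ} (hB : ∀ i j, 0 ≤ B i j) {c : ℝ}
    (hc : ∀ i, ∑ j, B i j ≤ c) (k : ℕ) (i : n) : ∑ j, (B ^ k) i j ≤ c ^ k := by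
  have hc0 : 0 ≤ c := (Finset.sum_nonneg fun j _ => hB i j).trans (hc i)
  induction k generalizing i with
  | zero => simp [Matrix.one_apply]
  | succ k ih =>
    have h : ∑ j, (B ^ (k + 1)) i j = ∑ l, B i l * ∑ j, (B ^ k) l j := by
      simp_rw [pow_succ', Matrix.mul_apply, Finset.mul_sum]
      exact Finset.sum_comm
    rw [h, pow_succ']
    calc ∑ l, B i l * ∑ j, (B ^ k) l j ≤ ∑ l, B i l * c ^ k :=
          Finset.sum_le_sum fun l _ => mul_le_mul_of_nonneg_left (ih l) (hB i l)
      _ = (∑ l, B i l) * c ^ k := by rw [Finset.sum_mul]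
      _ ≤ c * c ^ k := mul_le_mul_of_nonneg_right (hc i) (by positivity)

theorem sum_matrix_exp_le {B : Matrix n n ℝ} (hB : ∀ i j, 0 ≤ B i j) {c : ℝ}
    (hc : ∀ i, ∑ j, B i j ≤ c) (i : n) : ∑ j, NormedSpace.exp B i j ≤ Real.exp c := by
  have h1 := hasSum_sum (s := Finset.univ) fun j _ => hasSum_matrix_exp_apply B i j
  have h2 := NormedSpace.exp_series_hasSum_exp' (𝕂 := ℝ) c
  rw [← Real.exp_eq_exp_ℝ] at h2
  refine hasSum_le (fun k => ?_) h1 h2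
  rw [← Finset.mul_sum, smul_eq_mul]
  exact mul_le_mul_of_nonneg_left (sum_matrix_pow_le hB hc k i) (by positivity)

/-- Reduces matrices with nonnegative off-diagonal entries to entrywise nonnegative ones, for which
the power series can be bounded term by term. -/
theorem matrix_exp_shift (A : Matrix n n ℝ) (c : ℝ) (i j : n) :
    NormedSpace.exp A i j = Real.exp (-c) * NormedSpace.exp (A + c • (1 : Matrix n n ℝ)) i j := by
  have h1 : A = (A + c • (1 : Matrix n n ℝ)) + Matrix.diagonal fun _ : n => -c := by
    ext i j
    by_cases hij : i = j <;> simp [hij]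
  have h2 : Commute (A + c • (1 : Matrix n n ℝ)) (Matrix.diagonal fun _ : n => -c) := by
    have : (Matrix.diagonal fun _ : n => -c) = (-c) • (1 : Matrix n n ℝ) := by
      ext i j; by_cases hij : i = j <;> simp [hij]
    rw [this]
    exact (Commute.one_right _).smul_right _
  conv_lhs => rw [h1]
  rw [Matrix.exp_add_of_commute _ _ h2, Matrix.exp_diagonal, Matrix.mul_diagonal, mul_comm]
  congr 1
  rw [Pi.coe_exp, ← Real.exp_eq_exp_ℝ]

/-- Detailed balance says that conjugation by `diagonal m` turns `A` into its transpose; the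
exponential commutes with both operations. -/
theorem matrix_exp_symm {A : Matrix n n ℝ} {m : n → ℝ} (hm : ∀ i, 0 < m i)
    (hA : ∀ i j, m i * A i j = m j * A j i) (i j : n) :
    m i * NormedSpace.exp A i j = m j * NormedSpace.exp A j i := by
  have hU : IsUnit (Matrix.diagonal m) := by
    rw [Matrix.isUnit_diagonal]
    exact Pi.isUnit_iff.2 fun i => (hm i).ne'.isUnit
  have hdet : IsUnit (Matrix.diagonal m).det := (Matrix.isUnit_iff_isUnit_det _).1 hU
  have h1 : Matrix.diagonal m * A = A.transpose * Matrix.diagonal m := by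
    ext i j
    rw [Matrix.diagonal_mul, Matrix.mul_diagonal, Matrix.transpose_apply, hA, mul_comm]
  have h2 : Matrix.diagonal m * A * (Matrix.diagonal m)⁻¹ = A.transpose := by
    rw [h1, Matrix.mul_assoc, Matrix.mul_nonsing_inv _ hdet, Matrix.mul_one]
  have h3 := Matrix.exp_conj (Matrix.diagonal m) A hU
  rw [h2, Matrix.exp_transpose] at h3
  have h4 : (NormedSpace.exp A).transpose * Matrix.diagonal m
      = Matrix.diagonal m * NormedSpace.exp A := by
    rw [h3, Matrix.mul_assoc, Matrix.nonsing_inv_mul _ hdet, Matrix.mul_one]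
  have h5 := congrFun (congrFun h4 i) j
  rw [Matrix.diagonal_mul, Matrix.mul_diagonal, Matrix.transpose_apply] at h5
  rw [← h5, mul_comm]

end MatrixExp

/-! ### Dirichlet heat kernels and the minimal heat kernel. -/

namespace WeightedGraph

variable {V : Type*} (G : WeightedGraph V)

/-- The weighted degree `μ(x)⁻¹ ∑_y w_{xy}`. -/
def deg (x : V) : ℝ := (∑' y, G.w x y) / G.μ x

theorem w_nonneg (x y : V) : 0 ≤ G.w x y := by
  by_cases h : G.graph.Adj x y
  · exact (G.w_pos x y h).le
  · exact (G.w_eq_zero x y h).ge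

theorem w_self (x : V) : G.w x x = 0 := G.w_eq_zero x x (G.graph.irrefl)

theorem deg_nonneg (x : V) : 0 ≤ G.deg x :=
  div_nonneg (tsum_nonneg fun y => G.w_nonneg x y) (G.μ_pos x).le

variable {G}

theorem IsLocallyFinite.summable_w (hlf : G.IsLocallyFinite) (x : V) : Summable (G.w x) := by
  refine summable_of_hasFiniteSupport ((hlf x).subset fun y hy => ?_)
  by_contra hne
  exact hy (G.w_eq_zero x y hne)

variable (G)

theorem dirichletLaplacian_apply_ne (K : Finset V) {x y : K} (hxy : x ≠ y) :
    G.dirichletLaplacian K x y = G.w x y / G.μ x := by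
  have hxy' : (x : V) ≠ y := fun h => hxy (Subtype.ext h)
  simp only [dirichletLaplacian, Matrix.of_apply, laplacian]
  congr 1
  rw [tsum_eq_single (y : V)]
  · simp [hxy']
  · intro z hz; simp [hz, hxy']

theorem dirichletLaplacian_apply_self (K : Finset V) (x : K) :
    G.dirichletLaplacian K x x = -G.deg x := by
  simp only [dirichletLaplacian, Matrix.of_apply, laplacian, deg]
  rw [← neg_div, ← tsum_neg]
  congr 1
  refine tsum_congr fun z => ?_
  by_cases hz : z = x
  · simp [hz, w_self]
  · simp [hz]

theorem dirichletLaplacian_symm (K : Finset V) (x y : K) :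
    G.μ x * G.dirichletLaplacian K x y = G.μ y * G.dirichletLaplacian K y x := by
  by_cases hxy : x = y
  · rw [hxy]
  · rw [G.dirichletLaplacian_apply_ne K hxy, G.dirichletLaplacian_apply_ne K (Ne.symm hxy),
      mul_div_cancel₀ _ (G.μ_pos x).ne', mul_div_cancel₀ _ (G.μ_pos y).ne', G.w_symm]

variable {G}

-- Row sums are nonpositive because the diagonal carries the full degree, including edges that leave
-- `K`.
open Classical in
theorem IsLocallyFinite.sum_dirichletLaplacian_le (hlf : G.IsLocallyFinite) (K : Finset V)
    (x : K) : ∑ y, G.dirichletLaplacian K x y ≤ 0 := by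
  rw [← Finset.add_sum_erase _ _ (Finset.mem_univ x), dirichletLaplacian_apply_self]
  have h1 : ∑ y ∈ Finset.univ.erase x, G.dirichletLaplacian K x y
      = (∑ y ∈ Finset.univ.erase x, G.w x y) / G.μ x := by
    rw [Finset.sum_div]
    exact Finset.sum_congr rfl fun y hy =>
      G.dirichletLaplacian_apply_ne K (Finset.ne_of_mem_erase hy).symm
  have h2 : ∑ y ∈ Finset.univ.erase x, G.w x y ≤ ∑' y, G.w x y := by
    have := (hlf.summable_w x).sum_le_tsum ((Finset.univ.erase x).map (Function.Embedding.subtype _))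
      fun y _ => G.w_nonneg x y
    simpa using this
  rw [h1, deg]
  have := div_le_div_of_nonneg_right h2 (G.μ_pos x).le
  linarith

theorem dirichletHeatKernel_of_mem {K : Finset V} {x y : V} (hx : x ∈ K) (hy : y ∈ K) (t : ℝ) :
    G.dirichletHeatKernel K t x y = (by
      classical exact NormedSpace.exp (t • G.dirichletLaplacian K) ⟨x, hx⟩ ⟨y, hy⟩ / G.μ y) := by
  rw [dirichletHeatKernel, dif_pos ⟨hx, hy⟩]

section
open Classical

variable (G) in
theorem shifted_dirichletLaplacian_nonneg (K : Finset V) {c : ℝ} (hc : ∀ x ∈ K, G.deg x ≤ c)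
    {t : ℝ} (ht : 0 ≤ t) (x y : K) :
    0 ≤ (t • G.dirichletLaplacian K + (t * c) • (1 : Matrix K K ℝ)) x y := by
  simp only [Matrix.add_apply, Matrix.smul_apply, smul_eq_mul]
  by_cases hxy : x = y
  · subst hxy
    rw [dirichletLaplacian_apply_self, Matrix.one_apply_eq]
    have := mul_le_mul_of_nonneg_left (hc x x.2) ht
    linarith
  · rw [G.dirichletLaplacian_apply_ne K hxy, Matrix.one_apply_ne hxy]
    have := div_nonneg (G.w_nonneg x y) (G.μ_pos x).le
    rw [mul_zero, add_zero]
    exact mul_nonneg ht this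

-- The left side is the first two terms of the series of the shifted, nonnegative matrix. It
-- supplies nonnegativity, the diagonal lower bound, and strict positivity along edges.
variable (G) in
theorem le_exp_dirichletLaplacian (K : Finset V) {c : ℝ} (hc : ∀ x ∈ K, G.deg x ≤ c)
    {t : ℝ} (ht : 0 ≤ t) (x y : K) :
    Real.exp (-(t * c)) * ((1 : Matrix K K ℝ) x y
      + (t * G.dirichletLaplacian K x y + t * c * (1 : Matrix K K ℝ) x y)) ≤
      NormedSpace.exp (t • G.dirichletLaplacian K) x y := by
  rw [matrix_exp_shift _ (t * c)]
  have := one_add_le_matrix_exp (G.shifted_dirichletLaplacian_nonneg K hc ht) x y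
  exact mul_le_mul_of_nonneg_left (by simpa using this) (Real.exp_pos _).le

variable (G) in
theorem deg_le_sum (K : Finset V) : ∀ x ∈ K, G.deg x ≤ ∑ z ∈ K, G.deg z :=
  fun _ hx => Finset.single_le_sum (fun z _ => G.deg_nonneg z) hx

variable (G) in
theorem exp_dirichletLaplacian_nonneg (K : Finset V) {t : ℝ} (ht : 0 ≤ t) (x y : K) :
    0 ≤ NormedSpace.exp (t • G.dirichletLaplacian K) x y := by
  refine le_trans ?_ (G.le_exp_dirichletLaplacian K (G.deg_le_sum K) ht x y)
  have := G.shifted_dirichletLaplacian_nonneg K (G.deg_le_sum K) ht x y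
  simp only [Matrix.add_apply, Matrix.smul_apply, smul_eq_mul] at this
  refine mul_nonneg (Real.exp_pos _).le (add_nonneg ?_ this)
  rw [Matrix.one_apply]; split_ifs <;> norm_num

theorem IsLocallyFinite.exp_dirichletLaplacian_le_one (hlf : G.IsLocallyFinite) (K : Finset V)
    {t : ℝ} (ht : 0 ≤ t) (x y : K) : NormedSpace.exp (t • G.dirichletLaplacian K) x y ≤ 1 := by
  -- Any bound for the degrees in `K` serves as a shift; it cancels at the end, leaving total row
  -- mass at most $e^{-tc}e^{tc}=1$.
  set c := ∑ z ∈ K, G.deg z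
  refine (Finset.single_le_sum (fun z _ => G.exp_dirichletLaplacian_nonneg K ht x z)
    (Finset.mem_univ y)).trans ?_
  simp_rw [fun z => matrix_exp_shift (t • G.dirichletLaplacian K) (t * c) x z]
  rw [← Finset.mul_sum]
  have h := sum_matrix_exp_le (G.shifted_dirichletLaplacian_nonneg K (G.deg_le_sum K) ht)
    (c := t * c) (fun z => by
      simp only [Matrix.add_apply, Matrix.smul_apply, smul_eq_mul, Finset.sum_add_distrib]
      rw [← Finset.mul_sum, ← Finset.mul_sum]
      have h1 := hlf.sum_dirichletLaplacian_le K z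
      have h2 : ∑ j, (1 : Matrix K K ℝ) z j = 1 := by simp [Matrix.one_apply]
      rw [h2]
      have := mul_nonneg ht (neg_nonneg.2 h1)
      linarith) x
  calc _ ≤ Real.exp (-(t * c)) * Real.exp (t * c) :=
        mul_le_mul_of_nonneg_left h (Real.exp_pos _).le
    _ = 1 := by rw [← Real.exp_add]; simp

end

variable (G) in
theorem dirichletHeatKernel_nonneg (K : Finset V) {t : ℝ} (ht : 0 ≤ t) (x y : V) :
    0 ≤ G.dirichletHeatKernel K t x y := by
  rw [dirichletHeatKernel]
  split_ifs
  · exact div_nonneg (G.exp_dirichletLaplacian_nonneg K ht _ _) (G.μ_pos y).le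
  · exact le_rfl

theorem IsLocallyFinite.dirichletHeatKernel_le (hlf : G.IsLocallyFinite) (K : Finset V) {t : ℝ}
    (ht : 0 ≤ t) (x y : V) : G.dirichletHeatKernel K t x y ≤ 1 / G.μ y := by
  rw [dirichletHeatKernel]
  split_ifs
  · exact div_le_div_of_nonneg_right (hlf.exp_dirichletLaplacian_le_one K ht _ _) (G.μ_pos y).le
  · exact div_nonneg zero_le_one (G.μ_pos y).le

variable (G) in
theorem dirichletHeatKernel_symm (K : Finset V) (t : ℝ) (x y : V) :
    G.dirichletHeatKernel K t x y = G.dirichletHeatKernel K t y x := by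
  classical
  by_cases hxy : x ∈ K ∧ y ∈ K
  · rw [dirichletHeatKernel_of_mem hxy.1 hxy.2, dirichletHeatKernel_of_mem hxy.2 hxy.1,
      div_eq_div_iff (G.μ_pos y).ne' (G.μ_pos x).ne', mul_comm, mul_comm _ (G.μ y)]
    refine matrix_exp_symm (m := fun z : K => G.μ z) (fun z => G.μ_pos z) (fun z z' => ?_)
      ⟨x, hxy.1⟩ ⟨y, hxy.2⟩
    have := G.dirichletLaplacian_symm K z z'
    simp only [Matrix.smul_apply, smul_eq_mul]
    linear_combination t * this
  · rw [dirichletHeatKernel, dirichletHeatKernel, dif_neg hxy, dif_neg fun h => hxy h.symm]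

variable (G) in
theorem continuous_dirichletHeatKernel (K : Finset V) (x y : V) :
    Continuous fun t => G.dirichletHeatKernel K t x y := by
  classical
  by_cases hxy : x ∈ K ∧ y ∈ K
  · simp_rw [dirichletHeatKernel_of_mem hxy.1 hxy.2]
    exact (continuous_matrix_exp_smul_apply _ _ _).div_const _
  · simp_rw [dirichletHeatKernel, dif_neg hxy]
    exact continuous_const

theorem IsLocallyFinite.bddAbove_dirichletHeatKernel (hlf : G.IsLocallyFinite) {t : ℝ}
    (ht : 0 ≤ t) (x y : V) : BddAbove (Set.range fun K => G.dirichletHeatKernel K t x y) :=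
  ⟨1 / G.μ y, by rintro _ ⟨K, rfl⟩; exact hlf.dirichletHeatKernel_le K ht x y⟩

theorem IsLocallyFinite.dirichletHeatKernel_le_heatKernel (hlf : G.IsLocallyFinite)
    (K : Finset V) {t : ℝ} (ht : 0 ≤ t) (x y : V) :
    G.dirichletHeatKernel K t x y ≤ G.heatKernel t x y :=
  le_ciSup (hlf.bddAbove_dirichletHeatKernel ht x y) K

variable (G) in
theorem heatKernel_nonneg {t : ℝ} (ht : 0 ≤ t) (x y : V) : 0 ≤ G.heatKernel t x y :=
  Real.iSup_nonneg fun K => G.dirichletHeatKernel_nonneg K ht x y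

variable (G) in
theorem heatKernel_symm (t : ℝ) (x y : V) : G.heatKernel t x y = G.heatKernel t y x := by
  simp only [heatKernel, G.dirichletHeatKernel_symm _ t x y]

-- A countable vertex set has countably many finite subsets, so this is a countable supremum of
-- continuous functions.
variable (G) in
theorem measurable_heatKernel [Countable V] (x y : V) :
    Measurable fun t => G.heatKernel t x y :=
  Measurable.iSup fun K => (G.continuous_dirichletHeatKernel K x y).measurable

/-- Already the one-point set $K=\{x\}$, with Dirichlet Laplacian $-\deg x$, gives this. -/
theorem IsLocallyFinite.exp_le_heatKernel_self (hlf : G.IsLocallyFinite) {t : ℝ} (ht : 0 ≤ t)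
    (x : V) : Real.exp (-(t * G.deg x)) ≤ G.heatKernel t x x * G.μ x := by
  classical
  have hx : x ∈ ({x} : Finset V) := Finset.mem_singleton_self x
  have h1 := hlf.dirichletHeatKernel_le_heatKernel {x} ht x x
  have h2 := G.le_exp_dirichletLaplacian {x} (c := G.deg x) (by simp) ht ⟨x, hx⟩ ⟨x, hx⟩
  rw [dirichletHeatKernel_of_mem hx hx, div_le_iff₀ (G.μ_pos x)] at h1
  rw [dirichletLaplacian_apply_self, Matrix.one_apply_eq] at h2
  refine le_trans (le_of_eq ?_) (h2.trans h1)
  ring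

theorem IsLocallyFinite.heatKernel_pos_of_adj (hlf : G.IsLocallyFinite) {t : ℝ} (ht : 0 < t)
    {x y : V} (hxy : G.graph.Adj x y) : 0 < G.heatKernel t x y := by
  classical
  have hx : x ∈ ({x, y} : Finset V) := by simp
  have hy : y ∈ ({x, y} : Finset V) := by simp
  refine lt_of_lt_of_le ?_ (hlf.dirichletHeatKernel_le_heatKernel {x, y} ht.le x y)
  rw [dirichletHeatKernel_of_mem hx hy]
  refine div_pos (lt_of_lt_of_le ?_ (G.le_exp_dirichletLaplacian _ (G.deg_le_sum _) ht.le _ _))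
    (G.μ_pos y)
  have hne : (⟨x, hx⟩ : ({x, y} : Finset V)) ≠ ⟨y, hy⟩ := fun h =>
    hxy.ne (congrArg Subtype.val h)
  rw [Matrix.one_apply_ne hne, G.dirichletLaplacian_apply_ne _ hne]
  have := div_pos (G.w_pos x y hxy) (G.μ_pos x)
  simp only [mul_zero, add_zero, zero_add]
  positivity

end WeightedGraph

/-! ### The fractional kernel: integrability, row sums, positivity on edges. -/

-- The integrand is at most $Dt^{-s}$ near $0$, where $s<1$ is needed, and at most $t^{-1-s}$ near
-- infinity, where $s>0$ is needed.
open MeasureTheory Set in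
theorem integrableOn_min_mul_rpow {D s : ℝ} (hD : 0 ≤ D) (hs0 : 0 < s) (hs1 : s < 1) :
    IntegrableOn (fun t : ℝ => min 1 (D * t) * t ^ (-1 - s)) (Ioi 0) := by
  have hm : Measurable fun t : ℝ => min 1 (D * t) * t ^ (-1 - s) := by fun_prop
  rw [← Ioc_union_Ioi_eq_Ioi (zero_le_one' ℝ)]
  refine IntegrableOn.union ?_ ?_
  · have h1 : IntegrableOn (fun t : ℝ => D * t ^ (-s)) (Ioc 0 1) := by
      have := intervalIntegral.intervalIntegrable_rpow' (a := 0) (b := 1) (r := -s) (by linarith)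
      exact ((intervalIntegrable_iff_integrableOn_Ioc_of_le zero_le_one).1 this).const_mul D
    refine h1.mono' hm.aestronglyMeasurable ?_
    refine (ae_restrict_iff' measurableSet_Ioc).2 (Eventually.of_forall fun t ht => ?_)
    have ht0 : 0 < t := ht.1
    rw [Real.norm_of_nonneg (by positivity)]
    have : t ^ (-s) = t * t ^ (-1 - s) := by
      rw [← Real.rpow_one_add' ht0.le (by linarith)]; ring_nf
    rw [this, ← mul_assoc]
    exact mul_le_mul_of_nonneg_right (min_le_right _ _) (by positivity)
  · have h1 : IntegrableOn (fun t : ℝ => t ^ (-1 - s)) (Ioi 1) :=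
      integrableOn_Ioi_rpow_of_lt (by linarith) one_pos
    refine h1.mono' hm.aestronglyMeasurable ?_
    refine (ae_restrict_iff' measurableSet_Ioi).2 (Eventually.of_forall fun t ht => ?_)
    have ht0 : (0 : ℝ) < t := lt_trans one_pos ht
    rw [Real.norm_of_nonneg (by positivity)]
    exact mul_le_of_le_one_left (by positivity) (min_le_left _ _)

namespace WeightedGraph

variable {V : Type*} {G : WeightedGraph V}

/-- The total mass is $1$ and the diagonal retains at least $e^{-t\deg x}\ge1-t\deg x$; only the
rest can sit away from $x$. -/
theorem StochasticallyComplete.sum_heatKernel_le (hsc : G.StochasticallyComplete)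
    (hlf : G.IsLocallyFinite) {t : ℝ} (ht : 0 < t) {x : V} {S : Finset V} (hx : x ∉ S) :
    ∑ y ∈ S, G.heatKernel t x y * G.μ y ≤ min 1 (G.deg x * t) := by
  classical
  have hnn : ∀ y, 0 ≤ G.heatKernel t x y * G.μ y := fun y =>
    mul_nonneg (G.heatKernel_nonneg ht.le x y) (G.μ_pos y).le
  have h := sum_le_hasSum (insert x S) (fun y _ => hnn y) (hsc t ht x)
  rw [Finset.sum_insert hx] at h
  have h1 := hlf.exp_le_heatKernel_self ht.le x
  have h2 := Real.add_one_le_exp (-(t * G.deg x))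
  refine le_min ?_ ?_
  · linarith [hnn x]
  · linarith

open MeasureTheory Set in
theorem StochasticallyComplete.integrableOn_heatKernel [Countable V]
    (hsc : G.StochasticallyComplete)
    (hlf : G.IsLocallyFinite) {s : ℝ} (hs0 : 0 < s) (hs1 : s < 1) {x y : V} (hxy : x ≠ y) :
    IntegrableOn (fun t => G.heatKernel t x y * t ^ (-1 - s)) (Ioi 0) := by
  refine ((integrableOn_min_mul_rpow (G.deg_nonneg x) hs0 hs1).const_mul (G.μ y)⁻¹).mono'
    ((G.measurable_heatKernel x y).mul (by fun_prop)).aestronglyMeasurable ?_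
  refine (ae_restrict_iff' measurableSet_Ioi).2 (Eventually.of_forall fun t ht => ?_)
  have ht0 : (0 : ℝ) < t := ht
  have h := hsc.sum_heatKernel_le hlf ht0 (x := x) (S := {y}) (by simpa using hxy)
  rw [Finset.sum_singleton, mul_comm, ← le_inv_mul_iff₀ (G.μ_pos y)] at h
  rw [Real.norm_of_nonneg (mul_nonneg (G.heatKernel_nonneg ht0.le x y) (by positivity)),
    ← mul_assoc]
  exact mul_le_mul_of_nonneg_right h (by positivity)

variable (G) in
theorem kernel_self (s : ℝ) (x : V) : G.kernel s x x = 0 := if_pos rfl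

theorem kernel_const_pos {s : ℝ} (hs0 : 0 < s) (hs1 : s < 1) : 0 < s / Real.Gamma (1 - s) :=
  div_pos hs0 (Real.Gamma_pos_of_pos (by linarith))

variable (G) in
theorem kernel_nonneg {s : ℝ} (hs0 : 0 < s) (hs1 : s < 1) (x y : V) : 0 ≤ G.kernel s x y := by
  rw [kernel]
  split_ifs
  · exact le_rfl
  · refine mul_nonneg (mul_nonneg (kernel_const_pos hs0 hs1).le
      (mul_nonneg (G.μ_pos x).le (G.μ_pos y).le)) ?_
    refine MeasureTheory.setIntegral_nonneg measurableSet_Ioi fun t ht => ?_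
    exact mul_nonneg (G.heatKernel_nonneg (le_of_lt ht) x y) (Real.rpow_nonneg (le_of_lt ht) _)

variable (G) in
theorem kernel_symm (s : ℝ) (x y : V) : G.kernel s x y = G.kernel s y x := by
  by_cases hxy : x = y
  · rw [hxy]
  · simp only [kernel, if_neg hxy, if_neg (Ne.symm hxy), G.heatKernel_symm _ x y, mul_comm (G.μ x)]

open MeasureTheory Set in
theorem StochasticallyComplete.summable_kernel [Countable V]
    (hsc : G.StochasticallyComplete)
    (hlf : G.IsLocallyFinite) {s : ℝ} (hs0 : 0 < s) (hs1 : s < 1) (x : V) :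
    Summable (G.kernel s x) := by
  classical
  set C := s / Real.Gamma (1 - s) with hC
  have hCpos : 0 < C := kernel_const_pos hs0 hs1
  refine summable_of_sum_le (c := C * G.μ x *
    ∫ t in Ioi (0 : ℝ), min 1 (G.deg x * t) * t ^ (-1 - s))
    (fun y => G.kernel_nonneg hs0 hs1 x y) fun S => ?_
  -- The diagonal term is zero by convention; removing it permits the off-diagonal mass bound,
  -- uniform in `S`.
  rw [← Finset.sum_erase S (G.kernel_self s x)]
  have h1 : ∑ y ∈ S.erase x, G.kernel s x y = C * G.μ x *
      ∫ t in Ioi (0 : ℝ), ∑ y ∈ S.erase x, G.μ y * (G.heatKernel t x y * t ^ (-1 - s)) := by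
    rw [integral_finsetSum _ fun y hy => (hsc.integrableOn_heatKernel hlf hs0 hs1
      (Finset.ne_of_mem_erase hy).symm).const_mul _, Finset.mul_sum]
    refine Finset.sum_congr rfl fun y hy => ?_
    rw [kernel, if_neg (Finset.ne_of_mem_erase hy).symm, integral_const_mul]
    ring
  rw [h1]
  refine mul_le_mul_of_nonneg_left ?_ (mul_nonneg hCpos.le (G.μ_pos x).le)
  refine setIntegral_mono_on (integrable_finsetSum _ fun y hy =>
    (hsc.integrableOn_heatKernel hlf hs0 hs1 (Finset.ne_of_mem_erase hy).symm).const_mul _)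
    (integrableOn_min_mul_rpow (G.deg_nonneg x) hs0 hs1) measurableSet_Ioi fun t ht => ?_
  have h2 := hsc.sum_heatKernel_le hlf ht (Finset.notMem_erase x S)
  refine le_trans (le_of_eq ?_) (mul_le_mul_of_nonneg_right h2 (Real.rpow_nonneg (le_of_lt ht) _))
  rw [Finset.sum_mul]
  exact Finset.sum_congr rfl fun y _ => by ring

open MeasureTheory Set in
theorem StochasticallyComplete.kernel_pos_of_adj [Countable V]
    (hsc : G.StochasticallyComplete)
    (hlf : G.IsLocallyFinite) {s : ℝ} (hs0 : 0 < s) (hs1 : s < 1) {x y : V}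
    (hxy : G.graph.Adj x y) : 0 < G.kernel s x y := by
  rw [kernel, if_neg hxy.ne]
  refine mul_pos (mul_pos (kernel_const_pos hs0 hs1) (mul_pos (G.μ_pos x) (G.μ_pos y))) ?_
  have hpos : ∀ t ∈ Ioi (0 : ℝ), 0 < G.heatKernel t x y * t ^ (-1 - s) := fun t ht =>
    mul_pos (hlf.heatKernel_pos_of_adj ht hxy) (Real.rpow_pos_of_pos ht _)
  rw [setIntegral_pos_iff_support_of_nonneg_ae
    ((ae_restrict_iff' measurableSet_Ioi).2 (Eventually.of_forall fun t ht => (hpos t ht).le))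
    (hsc.integrableOn_heatKernel hlf hs0 hs1 hxy.ne)]
  have hsub : Ioi (0 : ℝ) ⊆ Function.support fun t => G.heatKernel t x y * t ^ (-1 - s) :=
    fun t ht => (hpos t ht).ne'
  rw [inter_eq_self_of_subset_right hsub]
  simp

/-- On a connected locally finite graph, functions tending to infinity with the distance tend to
infinity along the cofinite filter. -/
theorem IsLocallyFinite.tendsto_dist_cofinite (hlf : G.IsLocallyFinite)
    (hconn : G.graph.Connected) (x₀ : V) :
    Tendsto (fun x => G.graph.dist x x₀) cofinite atTop := by
  have hball : ∀ n : ℕ, {x | G.graph.dist x x₀ ≤ n}.Finite := by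
    intro n
    induction n with
    | zero =>
      refine (Set.finite_singleton x₀).subset fun x hx => ?_
      exact (hconn.dist_eq_zero_iff).1 (Nat.le_zero.1 hx)
    | succ n ih =>
      refine (ih.union (ih.biUnion fun y _ => hlf y)).subset fun x hx => ?_
      obtain ⟨p, hp⟩ := hconn.exists_walk_length_eq_dist x x₀
      cases p with
      | nil => left; simp
      | @cons _ y _ hxy q =>
        right
        refine Set.mem_biUnion (x := y) ?_ hxy.symm
        have h1 := SimpleGraph.dist_le q
        have h2 : G.graph.dist x x₀ ≤ n + 1 := hx
        rw [SimpleGraph.Walk.length_cons] at hp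
        show G.graph.dist y x₀ ≤ n
        omega
  refine tendsto_atTop.2 fun n => ?_
  rw [eventually_cofinite]
  exact (hball n).subset fun x hx => (not_le.1 hx).le

end WeightedGraph

theorem hasSum_of_eq {ι : Type*} {f g : ι → ℝ} {a b : ℝ} (hf : HasSum f a)
    (hfg : ∀ i, g i = f i) (hab : a = b) : HasSum g b := by
  rw [funext hfg, ← hab]; exact hf

/-! ### Weak convergence in $\ell^2$. -/

section SequenceSpace

variable {ι : Type*}

theorem memℓp_two_iff {a : ι → ℝ} : Memℓp a 2 ↔ Summable fun i => a i ^ 2 := by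
  rw [memℓp_gen_iff (by norm_num)]
  simp

theorem hasSum_lp_inner (a b : lp (fun _ : ι => ℝ) 2) :
    HasSum (fun i => a i * b i) (inner ℝ a b) := by
  simpa [mul_comm] using lp.hasSum_inner (𝕜 := ℝ) a b

/-- Bounded coordinatewise convergence is weak convergence: `ψ` is approximated in norm by finite
sections, for which the pairing is a finite sum. -/
theorem tendsto_inner_of_tendsto_pi {a : ℕ → lp (fun _ : ι => ℝ) 2} {b : lp (fun _ : ι => ℝ) 2}
    {R : ℝ} (hR : ∀ n, ‖a n‖ ≤ R) (hab : ∀ i, Tendsto (fun n => a n i) atTop (𝓝 (b i)))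
    (ψ : lp (fun _ : ι => ℝ) 2) :
    Tendsto (fun n => inner ℝ (a n) ψ) atTop (𝓝 (inner ℝ b ψ)) := by
  classical
  have hR0 : 0 ≤ R := (norm_nonneg _).trans (hR 0)
  have h1 : ∀ s : Finset ι, Tendsto (fun n => inner ℝ (a n) (∑ i ∈ s, lp.single 2 i (ψ i))) atTop
      (𝓝 (inner ℝ b (∑ i ∈ s, lp.single 2 i (ψ i)))) := by
    intro s
    simp_rw [inner_sum, lp.inner_single_right]
    exact tendsto_finsetSum _ fun i _ => Tendsto.inner (hab i) tendsto_const_nhds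
  have h2 : Tendsto (fun s : Finset ι => ∑ i ∈ s, lp.single 2 i (ψ i)) atTop (𝓝 ψ) :=
    lp.hasSum_single (by norm_num) ψ
  rw [Metric.tendsto_atTop]
  intro ε hε
  -- Replacing `ψ` by its section then costs at most `ε / 4` in total; the `1` keeps the denominator
  -- positive.
  set δ := ε / (4 * (R + ‖b‖ + 1)) with hδ
  have hden : 0 < 4 * (R + ‖b‖ + 1) := by positivity
  have hδ0 : 0 < δ := by positivity
  obtain ⟨s, hs⟩ := ((Metric.tendsto_nhds.1 h2) δ hδ0).exists
  obtain ⟨N, hN⟩ := (Metric.tendsto_atTop.1 (h1 s)) (ε / 2) (by positivity)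
  refine ⟨N, fun n hn => ?_⟩
  have h3 := hN n hn
  set σ := ∑ i ∈ s, lp.single 2 i (ψ i)
  rw [dist_comm, dist_eq_norm] at hs
  rw [Real.dist_eq] at h3 ⊢
  have e1 : |inner ℝ (a n) (ψ - σ)| ≤ R * δ :=
    (abs_real_inner_le_norm _ _).trans (mul_le_mul (hR n) hs.le (norm_nonneg _) hR0)
  have e2 : |inner ℝ b (ψ - σ)| ≤ ‖b‖ * δ :=
    (abs_real_inner_le_norm _ _).trans (mul_le_mul_of_nonneg_left hs.le (norm_nonneg _))
  have e3 : inner ℝ (a n) ψ - inner ℝ b ψ = (inner ℝ (a n) σ - inner ℝ b σ)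
      + inner ℝ (a n) (ψ - σ) - inner ℝ b (ψ - σ) := by
    rw [inner_sub_right, inner_sub_right]; ring
  have e4 : (R + ‖b‖) * δ ≤ ε / 4 := by
    have : (R + ‖b‖ + 1) * δ = ε / 4 := by rw [hδ]; field_simp
    nlinarith
  rw [e3]
  rw [abs_lt] at h3 ⊢
  rw [abs_le] at e1 e2
  constructor <;> nlinarith [e1.1, e1.2, e2.1, e2.2, h3.1, h3.2]

/-- A closed subspace is its own double orthogonal complement, hence weakly closed. -/
theorem mem_topologicalClosure_of_tendsto_pi (K : Submodule ℝ (lp (fun _ : ι => ℝ) 2))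
    {a : ℕ → lp (fun _ : ι => ℝ) 2} {b : lp (fun _ : ι => ℝ) 2}
    {R : ℝ} (hR : ∀ n, ‖a n‖ ≤ R) (hab : ∀ i, Tendsto (fun n => a n i) atTop (𝓝 (b i)))
    (ha : ∀ n, a n ∈ K.topologicalClosure) : b ∈ K.topologicalClosure := by
  rw [← Submodule.orthogonal_orthogonal_eq_closure, Submodule.mem_orthogonal']
  intro ψ hψ
  refine tendsto_nhds_unique (tendsto_inner_of_tendsto_pi hR hab ψ) ?_
  have : ∀ n, inner ℝ (a n) ψ = 0 := fun n => by
    have h := ha n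
    rw [← Submodule.orthogonal_orthogonal_eq_closure, Submodule.mem_orthogonal'] at h
    exact h ψ hψ
  simp [this]

end SequenceSpace

/-! ### The isometric embedding of finite energy functions. -/

namespace WeightedGraph

variable {V : Type*}

/-- The properties of the fractional kernel and of the potential that the variational problem
uses. -/
structure Regular (G : WeightedGraph V) (s : ℝ) (h : V → ℝ) : Prop where
  kernel_nonneg : ∀ x y, 0 ≤ G.kernel s x y
  kernel_symm : ∀ x y, G.kernel s x y = G.kernel s y x
  kernel_summable : ∀ x, Summable (G.kernel s x)
  μ_lower : ∃ μ₀ : ℝ, 0 < μ₀ ∧ ∀ x, μ₀ ≤ G.μ x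
  h_lower : ∃ h₀ : ℝ, 0 < h₀ ∧ ∀ x, h₀ ≤ h x

/-- The coordinates of `u` whose squares sum up to the energy. -/
def energyCoord (G : WeightedGraph V) (s : ℝ) (h : V → ℝ) (u : V → ℝ) : (V × V) ⊕ V → ℝ :=
  Sum.elim (fun p => √(G.kernel s p.1 p.2 / 2) * (u p.1 - u p.2)) fun x => √(h x * G.μ x) * u x

/-- The sequence space into which the functions of finite energy embed isometrically. -/
abbrev EnergySeq (V : Type*) := lp (fun _ : (V × V) ⊕ V => ℝ) 2

open Classical in
/-- The isometric embedding of the functions of finite energy into a sequence space. -/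
def energyVec (G : WeightedGraph V) (s : ℝ) (h : V → ℝ) (u : V → ℝ) : EnergySeq V :=
  if hu : Memℓp (G.energyCoord s h u) 2 then ⟨G.energyCoord s h u, hu⟩ else 0

/-- The functions with square summable energy coordinates. -/
def energySpace (G : WeightedGraph V) (s : ℝ) (h : V → ℝ) : Submodule ℝ (V → ℝ) where
  carrier := {u | Memℓp (G.energyCoord s h u) 2}
  add_mem' {u v} hu hv := by
    have : G.energyCoord s h (u + v) = G.energyCoord s h u + G.energyCoord s h v := by
      ext (p | x) <;> simp [energyCoord] <;> ring
    simpa only [Set.mem_ofPred_eq, this] using hu.add hv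
  zero_mem' := by
    have : G.energyCoord s h 0 = 0 := by
      ext (p | x) <;> simp [energyCoord]
    simpa only [Set.mem_ofPred_eq, this] using zero_memℓp
  smul_mem' c u hu := by
    have : G.energyCoord s h (c • u) = c • G.energyCoord s h u := by
      ext (p | x) <;> simp [energyCoord] <;> ring
    simpa only [Set.mem_ofPred_eq, this] using hu.const_smul c

variable {G : WeightedGraph V} {s : ℝ} {h : V → ℝ} {u v : V → ℝ}

theorem coe_energyVec (hu : u ∈ G.energySpace s h) :
    (G.energyVec s h u : (V × V) ⊕ V → ℝ) = G.energyCoord s h u := by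
  rw [energyVec, dif_pos (show Memℓp (G.energyCoord s h u) 2 from hu)]

theorem energyVec_inl (hu : u ∈ G.energySpace s h) (x y : V) :
    G.energyVec s h u (Sum.inl (x, y)) = √(G.kernel s x y / 2) * (u x - u y) := by
  rw [coe_energyVec hu]; rfl

theorem energyVec_inr (hu : u ∈ G.energySpace s h) (x : V) :
    G.energyVec s h u (Sum.inr x) = √(h x * G.μ x) * u x := by
  rw [coe_energyVec hu]; rfl

theorem energyVec_add (hu : u ∈ G.energySpace s h) (hv : v ∈ G.energySpace s h) :
    G.energyVec s h (u + v) = G.energyVec s h u + G.energyVec s h v := by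
  ext (p | x)
  · simp only [lp.coeFn_add, Pi.add_apply, energyVec_inl (add_mem hu hv), energyVec_inl hu,
      energyVec_inl hv]; ring
  · simp only [lp.coeFn_add, Pi.add_apply, energyVec_inr (add_mem hu hv), energyVec_inr hu,
      energyVec_inr hv]; ring

theorem energyVec_smul (c : ℝ) (hu : u ∈ G.energySpace s h) :
    G.energyVec s h (c • u) = c • G.energyVec s h u := by
  ext (p | x)
  · simp only [lp.coeFn_smul, Pi.smul_apply, energyVec_inl (Submodule.smul_mem _ c hu),
      energyVec_inl hu, smul_eq_mul]; ring
  · simp only [lp.coeFn_smul, Pi.smul_apply, energyVec_inr (Submodule.smul_mem _ c hu),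
      energyVec_inr hu, smul_eq_mul]; ring

theorem energyVec_sub (hu : u ∈ G.energySpace s h) (hv : v ∈ G.energySpace s h) :
    G.energyVec s h (u - v) = G.energyVec s h u - G.energyVec s h v := by
  have h1 := energyVec_add (sub_mem hu hv) hv
  rw [sub_add_cancel] at h1
  rw [h1, add_sub_cancel_right]

theorem abs_le_norm_energyVec (hu : u ∈ G.energySpace s h) (x : V) :
    √(h x * G.μ x) * |u x| ≤ ‖G.energyVec s h u‖ := by
  have h1 := lp.norm_apply_le_norm (p := 2) (by norm_num) (G.energyVec s h u) (Sum.inr x)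
  rwa [energyVec_inr hu, Real.norm_eq_abs, abs_mul, abs_of_nonneg (Real.sqrt_nonneg _)] at h1

namespace Regular

theorem h_pos (R : G.Regular s h) (x : V) : 0 < h x := by
  obtain ⟨h₀, h0, hh⟩ := R.h_lower; exact h0.trans_le (hh x)

theorem sqrt_kernel_mul (R : G.Regular s h) (x y : V) (a b : ℝ) :
    (√(G.kernel s x y / 2) * a) * (√(G.kernel s x y / 2) * b) = G.kernel s x y / 2 * (a * b) := by
  have := Real.mul_self_sqrt (div_nonneg (R.kernel_nonneg x y) zero_le_two)
  linear_combination (a * b) * this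

theorem sqrt_potential_mul (R : G.Regular s h) (x : V) (a b : ℝ) :
    (√(h x * G.μ x) * a) * (√(h x * G.μ x) * b) = h x * G.μ x * (a * b) := by
  have := Real.mul_self_sqrt (mul_nonneg (R.h_pos x).le (G.μ_pos x).le)
  linear_combination (a * b) * this

theorem summable_kernel_mul (R : G.Regular s h) (x : V) {a : V → ℝ} {C : ℝ}
    (ha : ∀ y, |a y| ≤ C) : Summable fun y => G.kernel s x y * a y := by
  refine Summable.of_norm_bounded ((R.kernel_summable x).mul_right C) fun y => ?_
  rw [Real.norm_eq_abs, abs_mul, abs_of_nonneg (R.kernel_nonneg x y)]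
  exact mul_le_mul_of_nonneg_left (ha y) (R.kernel_nonneg x y)

theorem summable_kernel_mul_sub (R : G.Regular s h) (hu : ∃ C, ∀ x, |u x| ≤ C) (x : V) :
    Summable fun y => G.kernel s x y * (u x - u y) := by
  obtain ⟨C, hC⟩ := hu
  exact R.summable_kernel_mul x (C := C + C) fun y =>
    (abs_sub _ _).trans (add_le_add (hC x) (hC y))

theorem summable_gradInner (R : G.Regular s h) (hu : ∃ C, ∀ x, |u x| ≤ C)
    (hv : ∃ C, ∀ x, |v x| ≤ C) (x : V) :
    Summable fun y => G.kernel s x y * ((u x - u y) * (v x - v y)) := by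
  obtain ⟨C, hC⟩ := hu
  obtain ⟨D, hD⟩ := hv
  refine R.summable_kernel_mul x (C := (C + C) * (D + D)) fun y => ?_
  rw [abs_mul]
  exact mul_le_mul ((abs_sub _ _).trans (add_le_add (hC x) (hC y)))
    ((abs_sub _ _).trans (add_le_add (hD x) (hD y))) (abs_nonneg _)
    (by linarith [(abs_nonneg _).trans (hC x)])

theorem hasSum_gradInner (R : G.Regular s h) (hu : ∃ C, ∀ x, |u x| ≤ C)
    (hv : ∃ C, ∀ x, |v x| ≤ C) (x : V) :
    HasSum (fun y => G.kernel s x y / 2 * ((u x - u y) * (v x - v y)))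
      (G.gradInner s u v x * G.μ x) := by
  have h1 := (R.summable_gradInner hu hv x).hasSum.mul_left (1 / 2)
  refine hasSum_of_eq h1 (fun y => by ring) ?_
  rw [gradInner]
  have := (G.μ_pos x).ne'
  field_simp

/-- Each vertex coordinate $\sqrt{h\mu}\,u$ is bounded by the norm, and $h\mu\ge h_0\mu_0$. -/
theorem exists_sup_bound (R : G.Regular s h) :
    ∃ κ : ℝ, 0 < κ ∧ ∀ u ∈ G.energySpace s h, ∀ x, |u x| ≤ κ * ‖G.energyVec s h u‖ := by
  obtain ⟨μ₀, hμ0, hμ⟩ := R.μ_lower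
  obtain ⟨h₀, hh0, hh⟩ := R.h_lower
  refine ⟨(√(h₀ * μ₀))⁻¹, by positivity, fun u hu x => ?_⟩
  rw [le_inv_mul_iff₀ (by positivity)]
  refine le_trans (mul_le_mul_of_nonneg_right (Real.sqrt_le_sqrt ?_) (abs_nonneg _))
    (abs_le_norm_energyVec hu x)
  exact mul_le_mul (hh x) (hμ x) hμ0.le (R.h_pos x).le

theorem bounded_of_mem_energySpace (R : G.Regular s h) (hu : u ∈ G.energySpace s h) :
    ∃ C, ∀ x, |u x| ≤ C := by
  obtain ⟨κ, -, hκ⟩ := R.exists_sup_bound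
  exact ⟨_, hκ u hu⟩

theorem mem_energySpace_iff (R : G.Regular s h) : u ∈ G.energySpace s h ↔
    (Summable fun p : V × V => G.kernel s p.1 p.2 / 2 * ((u p.1 - u p.2) * (u p.1 - u p.2))) ∧
      Summable fun x => h x * u x ^ 2 * G.μ x := by
  have e1 : ((fun i => G.energyCoord s h u i ^ 2) ∘ Sum.inl) =
      fun p : V × V => G.kernel s p.1 p.2 / 2 * ((u p.1 - u p.2) * (u p.1 - u p.2)) := by
    ext p
    simp only [Function.comp, energyCoord, Sum.elim_inl, sq, R.sqrt_kernel_mul]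
  have e2 : ((fun i => G.energyCoord s h u i ^ 2) ∘ Sum.inr) =
      fun x => h x * u x ^ 2 * G.μ x := by
    ext x
    simp only [Function.comp, energyCoord, Sum.elim_inr, sq, R.sqrt_potential_mul]
    ring
  have e0 : u ∈ G.energySpace s h ↔ Summable fun i => G.energyCoord s h u i ^ 2 := memℓp_two_iff
  rw [e0, ← e1, ← e2]
  exact ⟨fun H => ⟨H.comp_injective Sum.inl_injective, H.comp_injective Sum.inr_injective⟩,
    fun H => (H.1.hasSum.sum H.2.hasSum).summable⟩

theorem gradInner_self_nonneg (R : G.Regular s h) (u : V → ℝ) (x : V) :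
    0 ≤ G.gradInner s u u x :=
  div_nonneg (tsum_nonneg fun y => mul_nonneg (R.kernel_nonneg x y) (mul_self_nonneg _))
    (mul_nonneg zero_le_two (G.μ_pos x).le)

/-- Tonelli for a nonnegative double sum. Boundedness makes every inner series in `gradInner`
summable, so that its `tsum` is a true sum and not the default `0`. -/
theorem finiteEnergy_eq (R : G.Regular s h) : G.finiteEnergy s h = G.energySpace s h := by
  ext u
  simp only [SetLike.mem_coe]
  have hn : 0 ≤ fun p : V × V =>
      G.kernel s p.1 p.2 / 2 * ((u p.1 - u p.2) * (u p.1 - u p.2)) := fun p =>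
    mul_nonneg (div_nonneg (R.kernel_nonneg _ _) zero_le_two) (mul_self_nonneg _)
  constructor
  · rintro ⟨hb, hu⟩
    have hg : ∀ x, 0 ≤ G.gradInner s u u x * G.μ x := fun x =>
      mul_nonneg (R.gradInner_self_nonneg u x) (G.μ_pos x).le
    have hp : ∀ x, 0 ≤ h x * u x ^ 2 * G.μ x := fun x =>
      mul_nonneg (mul_nonneg (R.h_pos x).le (sq_nonneg _)) (G.μ_pos x).le
    rw [R.mem_energySpace_iff, summable_prod_of_nonneg hn]
    refine ⟨⟨fun x => (R.hasSum_gradInner hb hb x).summable, ?_⟩, ?_⟩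
    · simp_rw [fun x => (R.hasSum_gradInner hb hb x).tsum_eq]
      refine Summable.of_nonneg_of_le hg (fun x => ?_) hu
      rw [add_mul]; linarith [hp x]
    · refine Summable.of_nonneg_of_le hp (fun x => ?_) hu
      rw [add_mul]; linarith [hg x]
  · intro hu
    have hb := R.bounded_of_mem_energySpace hu
    refine ⟨hb, ?_⟩
    rw [R.mem_energySpace_iff, summable_prod_of_nonneg hn] at hu
    have h1 := hu.1.2
    simp_rw [fun x => (R.hasSum_gradInner hb hb x).tsum_eq] at h1
    simpa only [add_mul] using h1.add hu.2

theorem hasSum_inner (R : G.Regular s h) (hu : u ∈ G.energySpace s h)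
    (hv : v ∈ G.energySpace s h) :
    HasSum (fun x => (G.gradInner s u v x + h x * u x * v x) * G.μ x)
      (inner ℝ (G.energyVec s h u) (G.energyVec s h v)) := by
  have h0 := hasSum_lp_inner (G.energyVec s h u) (G.energyVec s h v)
  have h1 := h0.summable.comp_injective (Sum.inl_injective (α := V × V) (β := V))
  have h2 := h0.summable.comp_injective (Sum.inr_injective (α := V × V) (β := V))
  have h3 := (h1.hasSum.sum h2.hasSum).unique h0
  have h4 : HasSum (fun x => G.gradInner s u v x * G.μ x) _ :=
    h1.hasSum.prod_fiberwise fun x => by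
      refine hasSum_of_eq (R.hasSum_gradInner (R.bounded_of_mem_energySpace hu)
        (R.bounded_of_mem_energySpace hv) x) (fun y => ?_) rfl
      simp only [Function.comp, energyVec_inl hu, energyVec_inl hv, R.sqrt_kernel_mul]
  have h5 := h4.add h2.hasSum
  rw [h3] at h5
  refine hasSum_of_eq h5 (fun x => ?_) rfl
  simp only [Function.comp, energyVec_inr hu, energyVec_inr hv, R.sqrt_potential_mul]
  ring

theorem normSq_eq (R : G.Regular s h) (hu : u ∈ G.energySpace s h) :
    G.normSq s h u = ‖G.energyVec s h u‖ ^ 2 := by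
  rw [← real_inner_self_eq_norm_sq, ← (R.hasSum_inner hu hu).tsum_eq, normSq, integral]
  exact tsum_congr fun x => by ring

theorem norm_eq (R : G.Regular s h) (hu : u ∈ G.energySpace s h) :
    G.norm s h u = ‖G.energyVec s h u‖ := by
  rw [norm, R.normSq_eq hu, Real.sqrt_sq (norm_nonneg _)]

section Delta

variable [DecidableEq V]

theorem hasSum_prod_single_left {a : V × V → ℝ} {z : V} {b : ℝ}
    (ha : HasSum (fun y => a (z, y)) b) :
    HasSum (fun p : V × V => a p * (Pi.single z 1 : V → ℝ) p.1) b := by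
  have hinj : Function.Injective fun y : V => (z, y) := Prod.mk_right_injective z
  rw [← hinj.hasSum_iff]
  · simpa [Function.comp_def] using ha
  · rintro ⟨x, y⟩ hxy
    have : x ≠ z := fun h => hxy ⟨y, by rw [h]⟩
    simp [this]

theorem hasSum_prod_single_right {a : V × V → ℝ} {z : V} {b : ℝ}
    (ha : HasSum (fun x => a (x, z)) b) :
    HasSum (fun p : V × V => a p * (Pi.single z 1 : V → ℝ) p.2) b := by
  have hinj : Function.Injective fun x : V => (x, z) := Prod.mk_left_injective z
  rw [← hinj.hasSum_iff]
  · simpa [Function.comp_def] using ha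
  · rintro ⟨x, y⟩ hxy
    have : y ≠ z := fun h => hxy ⟨x, by rw [h]⟩
    simp [this]

theorem single_mem (R : G.Regular s h) (z : V) : Pi.single z 1 ∈ G.energySpace s h := by
  rw [R.mem_energySpace_iff]
  constructor
  · have h1 : HasSum (fun y => (fun p : V × V => G.kernel s p.1 p.2) (z, y))
        (∑' y, G.kernel s z y) := (R.kernel_summable z).hasSum
    have h2 : HasSum (fun x => (fun p : V × V => G.kernel s p.1 p.2) (x, z))
        (∑' y, G.kernel s z y) := by
      exact hasSum_of_eq (R.kernel_summable z).hasSum (fun x => R.kernel_symm x z) rfl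
    refine Summable.of_nonneg_of_le (fun p => mul_nonneg
      (div_nonneg (R.kernel_nonneg _ _) zero_le_two) (mul_self_nonneg _)) (fun p => ?_)
      ((hasSum_prod_single_left (a := fun p : V × V => G.kernel s p.1 p.2) h1).add
        (hasSum_prod_single_right (a := fun p : V × V => G.kernel s p.1 p.2) h2)).summable
    have h3 := R.kernel_nonneg p.1 p.2
    -- Only pairs in the row or the column of `z` contribute, and both have finite kernel sum.
    have key : ∀ k a b : ℝ, 0 ≤ k → (a = 0 ∨ a = 1) → (b = 0 ∨ b = 1) →
        k / 2 * ((a - b) * (a - b)) ≤ k * a + k * b := by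
      rintro k a b hk (rfl | rfl) (rfl | rfl) <;> linarith
    exact key _ _ _ h3 (by rw [Pi.single_apply]; split_ifs <;> simp)
      (by rw [Pi.single_apply]; split_ifs <;> simp)
  · refine summable_of_ne_finset_zero (s := {z}) fun x hx => ?_
    have : x ≠ z := by simpa using hx
    simp [this]

/-- This turns testing against a point mass into the pointwise operator. The row and the column of
`z` contribute equal halves by symmetry of the kernel. -/
theorem inner_single (R : G.Regular s h) (hu : u ∈ G.energySpace s h) (z : V) :
    inner ℝ (G.energyVec s h u) (G.energyVec s h (Pi.single z 1)) =
      (G.fracLaplacian s u z + h z * u z) * G.μ z := by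
  have hs := R.single_mem (G := G) (s := s) (h := h) z
  have hb := R.bounded_of_mem_energySpace hu
  have h1 := (R.summable_kernel_mul_sub hb z).hasSum.mul_left (1 / 2)
  have h2 : HasSum (fun y => (fun p : V × V => G.kernel s p.1 p.2 / 2 * (u p.1 - u p.2)) (z, y))
      (1 / 2 * ∑' y, G.kernel s z y * (u z - u y)) := by
    exact hasSum_of_eq h1 (fun y => by ring) rfl
  have h3 : HasSum (fun y => (fun p : V × V => G.kernel s p.1 p.2 / 2 * (u p.2 - u p.1)) (y, z))
      (1 / 2 * ∑' y, G.kernel s z y * (u z - u y)) := by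
    exact hasSum_of_eq h1 (fun y => by simp only [R.kernel_symm y z]; ring) rfl
  have h4 := (hasSum_prod_single_left
      (a := fun p : V × V => G.kernel s p.1 p.2 / 2 * (u p.1 - u p.2)) h2).add
    (hasSum_prod_single_right
      (a := fun p : V × V => G.kernel s p.1 p.2 / 2 * (u p.2 - u p.1)) h3)
  have h5 : HasSum (fun x => h x * G.μ x * (u x * (Pi.single z 1 : V → ℝ) x))
      (h z * G.μ z * (u z * (Pi.single z 1 : V → ℝ) z)) :=
    hasSum_single z fun x hx => by simp [hx]
  have h6 := hasSum_lp_inner (G.energyVec s h u) (G.energyVec s h (Pi.single z 1))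
  have h8 : HasSum ((fun i => G.energyVec s h u i * G.energyVec s h (Pi.single z 1) i) ∘ Sum.inl)
      (1 / 2 * ∑' y, G.kernel s z y * (u z - u y) + 1 / 2 * ∑' y, G.kernel s z y * (u z - u y)) := by
    refine hasSum_of_eq h4 (fun p => ?_) rfl
    simp only [Function.comp, energyVec_inl hu p.1 p.2, energyVec_inl hs p.1 p.2,
      R.sqrt_kernel_mul]
    ring
  have h9 : HasSum ((fun i => G.energyVec s h u i * G.energyVec s h (Pi.single z 1) i) ∘ Sum.inr)
      (h z * G.μ z * (u z * (Pi.single z 1 : V → ℝ) z)) := by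
    refine hasSum_of_eq h5 (fun x => ?_) rfl
    simp only [Function.comp, energyVec_inr hu, energyVec_inr hs, R.sqrt_potential_mul]
  have h7 := HasSum.sum h8 h9
  refine (h6.unique h7).trans ?_
  rw [fracLaplacian, Pi.single_eq_same]
  have := (G.μ_pos z).ne'
  field_simp
  ring

end Delta

end Regular
end WeightedGraph

/-! ### Compactness from the coercive potential. -/

/-- If the nonnegative functions `a n` converge pointwise and their sums with the coercive weight
`h` are bounded, then their sums converge. -/
theorem tendsto_tsum_of_coercive {V : Type*} {h : V → ℝ} (hh : Tendsto h cofinite atTop)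
    (hl : ∃ h₀ : ℝ, 0 < h₀ ∧ ∀ x, h₀ ≤ h x) {a : ℕ → V → ℝ} {b : V → ℝ} {C : ℝ}
    (ha : ∀ n x, 0 ≤ a n x) (hC : ∀ n (S : Finset V), ∑ x ∈ S, h x * a n x ≤ C)
    (hab : ∀ x, Tendsto (fun n => a n x) atTop (𝓝 (b x))) :
    Tendsto (fun n => ∑' x, a n x) atTop (𝓝 (∑' x, b x)) := by
  classical
  obtain ⟨h₀, h0, hl⟩ := hl
  have hC0 : 0 ≤ C := by simpa using hC 0 ∅
  have hb : ∀ x, 0 ≤ b x := fun x => ge_of_tendsto' (hab x) fun n => ha n x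
  have hCb : ∀ S : Finset V, ∑ x ∈ S, h x * b x ≤ C := fun S =>
    le_of_tendsto' (tendsto_finsetSum S fun x _ => (hab x).const_mul (h x)) fun n => hC n S
  have hsum : ∀ c : V → ℝ, (∀ x, 0 ≤ c x) → (∀ S : Finset V, ∑ x ∈ S, h x * c x ≤ C) →
      Summable c := fun c hc hS => by
    have h1 : Summable fun x => h x * c x :=
      summable_of_sum_le (fun x => mul_nonneg (h0.le.trans (hl x)) (hc x)) hS
    refine Summable.of_nonneg_of_le hc (fun x => ?_) (h1.mul_left h₀⁻¹)
    rw [le_inv_mul_iff₀ h0]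
    exact mul_le_mul_of_nonneg_right (hl x) (hc x)
  -- Chebyshev: where `h ≥ H`, the mass is at most `C / H`.
  have htail : ∀ (H : ℝ) (K : Finset V), 0 < H → (∀ x ∉ K, H ≤ h x) → ∀ c : V → ℝ,
      (∀ x, 0 ≤ c x) → (∀ S : Finset V, ∑ x ∈ S, h x * c x ≤ C) →
      ∑' x, c x ≤ ∑ x ∈ K, c x + C / H := fun H K hH hK c hc hS => by
    refine (hsum c hc hS).tsum_le_of_sum_le fun S => ?_
    have h1 : ∑ x ∈ S, c x ≤ ∑ x ∈ K, c x + ∑ x ∈ S \ K, c x := by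
      rw [← Finset.sum_inter_add_sum_sdiff S K]
      have : ∑ x ∈ S ∩ K, c x ≤ ∑ x ∈ K, c x :=
        Finset.sum_le_sum_of_subset_of_nonneg Finset.inter_subset_right fun x _ _ => hc x
      linarith
    have h2 : ∑ x ∈ S \ K, c x ≤ C / H := by
      rw [le_div_iff₀ hH, Finset.sum_mul]
      refine le_trans (Finset.sum_le_sum fun x hx => ?_) (hS (S \ K))
      rw [mul_comm]
      exact mul_le_mul_of_nonneg_right (hK x (Finset.mem_sdiff.1 hx).2) (hc x)
    linarith
  rw [Metric.tendsto_atTop]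
  intro ε hε
  -- Makes both tails at most `ε / 4`, leaving `ε / 2` for the finite sum over `K`.
  set H := 4 * (C + 1) / ε with hH
  have hH0 : 0 < H := by positivity
  have hfin : {x | ¬ H ≤ h x}.Finite := eventually_cofinite.1 (hh.eventually_ge_atTop H)
  set K := hfin.toFinset
  have hK : ∀ x ∉ K, H ≤ h x := fun x hx => by
    by_contra hne; exact hx (hfin.mem_toFinset.2 hne)
  have hCH : C / H ≤ ε / 4 := by
    rw [div_le_iff₀ hH0, hH]
    have : ε / 4 * (4 * (C + 1) / ε) = C + 1 := by field_simp
    linarith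
  obtain ⟨N, hN⟩ := Metric.tendsto_atTop.1 (tendsto_finsetSum K fun x _ => hab x) (ε / 2)
    (by positivity)
  refine ⟨N, fun n hn => ?_⟩
  have h1 := hN n hn
  rw [Real.dist_eq, abs_lt] at h1 ⊢
  have h2 := htail H K hH0 hK (a n) (ha n) (hC n)
  have h3 := htail H K hH0 hK b hb hCb
  have h4 := (hsum (a n) (ha n) (hC n)).sum_le_tsum K fun x _ => ha n x
  have h5 := (hsum b hb hCb).sum_le_tsum K fun x _ => hb x
  constructor <;> linarith [h1.1, h1.2]

/-- Tychonoff; countability of `V` makes the product metrizable, hence sequentially compact. -/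
theorem exists_subseq_tendsto_pi {V : Type*} [Countable V] {u : ℕ → V → ℝ} {M : ℝ}
    (hM : ∀ n x, |u n x| ≤ M) :
    ∃ (v : V → ℝ) (σ : ℕ → ℕ), StrictMono σ ∧
      ∀ x, Tendsto (fun n => u (σ n) x) atTop (𝓝 (v x)) := by
  have hc : IsCompact (Set.univ.pi fun _ : V => Set.Icc (-M) M) :=
    isCompact_univ_pi fun _ => isCompact_Icc
  obtain ⟨v, -, σ, hσ, hv⟩ := hc.tendsto_subseq (x := u) fun n x _ => abs_le.1 (hM n x)
  exact ⟨v, σ, hσ, fun x => (tendsto_pi_nhds.1 hv) x⟩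

/-! ### The space $\mathscr H_s$ as a closed subspace of $\ell^2$. -/

namespace WeightedGraph

variable {V : Type*}

open Classical in
/-- The image of the finitely supported functions in the sequence space. -/
def testSpan (G : WeightedGraph V) (s : ℝ) (h : V → ℝ) : Submodule ℝ (EnergySeq V) :=
  Submodule.span ℝ (Set.range fun z => G.energyVec s h (Pi.single z 1))

variable {G : WeightedGraph V} {s : ℝ} {h : V → ℝ} {u v : V → ℝ}

namespace Regular

theorem mem_of_finite_support (R : G.Regular s h) {φ : V → ℝ} (hφ : (Function.support φ).Finite) :
    φ ∈ G.energySpace s h ∧ G.energyVec s h φ ∈ G.testSpan s h := by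
  classical
  have h1 : ∀ S : Finset V, (∑ z ∈ S, φ z • (Pi.single z 1 : V → ℝ)) ∈ G.energySpace s h ∧
      G.energyVec s h (∑ z ∈ S, φ z • (Pi.single z 1 : V → ℝ)) ∈ G.testSpan s h := by
    intro S
    induction S using Finset.induction_on with
    | empty =>
      refine ⟨by simp, ?_⟩
      have h0 := energyVec_smul (G := G) (s := s) (h := h) 0 (zero_mem _)
      rw [zero_smul, zero_smul] at h0
      simp [h0]
    | insert z S hz ih =>
      have h2 := Submodule.smul_mem _ (φ z) (R.single_mem z)
      rw [Finset.sum_insert hz, energyVec_add h2 ih.1, energyVec_smul _ (R.single_mem z)]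
      refine ⟨add_mem h2 ih.1, add_mem (Submodule.smul_mem _ _ (Submodule.subset_span ⟨z, ?_⟩)) ih.2⟩
      congr!
  have h2 : ∑ z ∈ hφ.toFinset, φ z • (Pi.single z 1 : V → ℝ) = φ := by
    ext x
    simp only [Finset.sum_apply, Pi.smul_apply, Pi.single_apply, smul_eq_mul, mul_ite, mul_one,
      mul_zero, Finset.sum_ite_eq, Set.Finite.mem_toFinset, Function.mem_support]
    split_ifs with hx
    · rfl
    · exact (not_not.1 hx).symm
  rw [← h2]
  exact h1 _

theorem exists_of_mem_testSpan (R : G.Regular s h) {a : EnergySeq V} (ha : a ∈ G.testSpan s h) :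
    ∃ φ : V → ℝ, (Function.support φ).Finite ∧ G.energyVec s h φ = a := by
  classical
  induction ha using Submodule.span_induction with
  | mem a ha =>
    obtain ⟨z, rfl⟩ := ha
    refine ⟨_, (Set.finite_singleton z).subset fun x hx => ?_, rfl⟩
    by_contra hne
    exact hx (Pi.single_eq_of_ne hne _)
  | zero =>
    refine ⟨0, by simp, ?_⟩
    have h0 := energyVec_smul (G := G) (s := s) (h := h) 0 (zero_mem _)
    rwa [zero_smul, zero_smul] at h0
  | add a b _ _ iha ihb =>
    obtain ⟨φ, hφ, rfl⟩ := iha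
    obtain ⟨ψ, hψ, rfl⟩ := ihb
    exact ⟨φ + ψ, (hφ.union hψ).subset (Function.support_add φ ψ),
      energyVec_add (R.mem_of_finite_support hφ).1 (R.mem_of_finite_support hψ).1⟩
  | smul c a _ iha =>
    obtain ⟨φ, hφ, rfl⟩ := iha
    exact ⟨c • φ, hφ.subset (Function.support_const_smul_subset c φ),
      energyVec_smul c (R.mem_of_finite_support hφ).1⟩

theorem mem_Hs_iff (R : G.Regular s h) : u ∈ G.Hs s h ↔ u ∈ G.energySpace s h ∧
    G.energyVec s h u ∈ (G.testSpan s h).topologicalClosure := by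
  rw [Hs, Set.mem_ofPred_eq, R.finiteEnergy_eq, SetLike.mem_coe]
  refine and_congr_right fun hu => ?_
  rw [← SetLike.mem_coe, Submodule.topologicalClosure_coe]
  constructor
  · rintro ⟨φ, hφ, hlim⟩
    have h1 : Tendsto (fun n => G.energyVec s h (φ n)) atTop (𝓝 (G.energyVec s h u)) := by
      rw [tendsto_iff_norm_sub_tendsto_zero]
      refine hlim.congr fun n => ?_
      have hn := (R.mem_of_finite_support (hφ n)).1
      rw [R.norm_eq (sub_mem hn hu), energyVec_sub hn hu]
    exact mem_closure_of_tendsto h1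
      (Eventually.of_forall fun n => (R.mem_of_finite_support (hφ n)).2)
  · intro hcl
    obtain ⟨a, ha, hlim⟩ := mem_closure_iff_seq_limit.1 hcl
    choose φ hφ hφa using fun n => R.exists_of_mem_testSpan (ha n)
    refine ⟨φ, hφ, ?_⟩
    rw [tendsto_iff_norm_sub_tendsto_zero] at hlim
    refine hlim.congr fun n => ?_
    have hn := (R.mem_of_finite_support (hφ n)).1
    rw [R.norm_eq (sub_mem hn hu), energyVec_sub hn hu, hφa]

theorem mem_energySpace (R : G.Regular s h) (hu : u ∈ G.Hs s h) : u ∈ G.energySpace s h :=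
  (R.mem_Hs_iff.1 hu).1

theorem add_mem_Hs (R : G.Regular s h) (hu : u ∈ G.Hs s h) (hv : v ∈ G.Hs s h) :
    u + v ∈ G.Hs s h := by
  rw [R.mem_Hs_iff] at hu hv ⊢
  rw [energyVec_add hu.1 hv.1]
  exact ⟨add_mem hu.1 hv.1, add_mem hu.2 hv.2⟩

theorem smul_mem_Hs (R : G.Regular s h) (c : ℝ) (hu : u ∈ G.Hs s h) : c • u ∈ G.Hs s h := by
  rw [R.mem_Hs_iff] at hu ⊢
  rw [energyVec_smul c hu.1]
  exact ⟨Submodule.smul_mem _ c hu.1, Submodule.smul_mem _ c hu.2⟩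

theorem mem_Hs_of_finite_support (R : G.Regular s h) (hu : (Function.support u).Finite) :
    u ∈ G.Hs s h :=
  R.mem_Hs_iff.2 ⟨(R.mem_of_finite_support hu).1,
    Submodule.le_topologicalClosure _ (R.mem_of_finite_support hu).2⟩

theorem single_mem_Hs [DecidableEq V] (R : G.Regular s h) (z : V) : Pi.single z 1 ∈ G.Hs s h :=
  R.mem_Hs_of_finite_support ((Set.finite_singleton z).subset fun x hx => by
    by_contra hne
    exact hx (Pi.single_eq_of_ne hne _))

theorem tendsto_energyVec_apply {u : ℕ → V → ℝ}
    (hu : ∀ n, u n ∈ G.energySpace s h) (hv : ∀ x, Tendsto (fun n => u n x) atTop (𝓝 (v x)))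
    (i : (V × V) ⊕ V) :
    Tendsto (fun n => G.energyVec s h (u n) i) atTop (𝓝 (G.energyCoord s h v i)) := by
  simp_rw [fun n => coe_energyVec (hu n)]
  rcases i with p | x
  · exact ((hv p.1).sub (hv p.2)).const_mul _
  · exact (hv x).const_mul _

/-- Pointwise limits of norm bounded sequences in `ℋ_s` belong to `ℋ_s`. -/
theorem mem_Hs_of_tendsto (R : G.Regular s h) {u : ℕ → V → ℝ} (hu : ∀ n, u n ∈ G.Hs s h) {C : ℝ}
    (hC : ∀ n, ‖G.energyVec s h (u n)‖ ≤ C)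
    (hv : ∀ x, Tendsto (fun n => u n x) atTop (𝓝 (v x))) : v ∈ G.Hs s h := by
  have hu' := fun n => R.mem_energySpace (hu n)
  have hlim := tendsto_energyVec_apply hu' hv
  have hvE : v ∈ G.energySpace s h := by
    refine lp.memℓp_of_tendsto (F := fun n => G.energyVec s h (u n)) (l := atTop) ?_
      (tendsto_pi_nhds.2 hlim)
    refine isBounded_iff_forall_norm_le.2 ⟨C, ?_⟩
    rintro _ ⟨n, rfl⟩
    exact hC n
  refine R.mem_Hs_iff.2 ⟨hvE, ?_⟩
  refine mem_topologicalClosure_of_tendsto_pi (G.testSpan s h) hC (fun i => ?_)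
    fun n => (R.mem_Hs_iff.1 (hu n)).2
  rw [coe_energyVec hvE]
  exact hlim i

/-- Fatou's lemma: finite partial sums of squared coordinates pass to the limit. -/
theorem norm_energyVec_le_of_tendsto (R : G.Regular s h) {u : ℕ → V → ℝ}
    (hu : ∀ n, u n ∈ G.Hs s h) (hvE : v ∈ G.Hs s h) {L : ℝ}
    (hL : Tendsto (fun n => ‖G.energyVec s h (u n)‖ ^ 2) atTop (𝓝 L))
    (hv : ∀ x, Tendsto (fun n => u n x) atTop (𝓝 (v x))) : ‖G.energyVec s h v‖ ^ 2 ≤ L := by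
  have hu' := fun n => R.mem_energySpace (hu n)
  have hv' := R.mem_energySpace hvE
  have hlim := tendsto_energyVec_apply hu' hv
  have h1 := hasSum_lp_inner (G.energyVec s h v) (G.energyVec s h v)
  rw [real_inner_self_eq_norm_sq] at h1
  rw [← h1.tsum_eq]
  refine h1.summable.tsum_le_of_sum_le fun S => ?_
  rw [coe_energyVec hv']
  refine le_of_tendsto_of_tendsto' (tendsto_finsetSum S fun i _ => (hlim i).mul (hlim i)) hL
    fun n => ?_
  have h2 := hasSum_lp_inner (G.energyVec s h (u n)) (G.energyVec s h (u n))
  rw [real_inner_self_eq_norm_sq] at h2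
  exact sum_le_hasSum S (fun i _ => mul_self_nonneg _) h2

theorem sum_potential_le (R : G.Regular s h) (hu : u ∈ G.energySpace s h) (S : Finset V) :
    ∑ x ∈ S, h x * (u x ^ 2 * G.μ x) ≤ ‖G.energyVec s h u‖ ^ 2 := by
  have h2 := hasSum_lp_inner (G.energyVec s h u) (G.energyVec s h u)
  rw [real_inner_self_eq_norm_sq] at h2
  refine le_trans (le_of_eq ?_)
    (sum_le_hasSum (S.map Function.Embedding.inr) (fun i _ => mul_self_nonneg _) h2)
  rw [Finset.sum_map]
  refine Finset.sum_congr rfl fun x _ => ?_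
  rw [Function.Embedding.inr_apply, energyVec_inr hu, R.sqrt_potential_mul]
  ring

theorem summable_sq (R : G.Regular s h) (hu : u ∈ G.energySpace s h) :
    Summable fun x => u x ^ 2 * G.μ x := by
  obtain ⟨h₀, h0, hl⟩ := R.h_lower
  have hn : ∀ x, 0 ≤ u x ^ 2 * G.μ x := fun x => mul_nonneg (sq_nonneg _) (G.μ_pos x).le
  have h1 : Summable fun x => h x * (u x ^ 2 * G.μ x) :=
    summable_of_sum_le (fun x => mul_nonneg (R.h_pos x).le (hn x)) (R.sum_potential_le hu)
  refine Summable.of_nonneg_of_le hn (fun x => ?_) (h1.mul_left h₀⁻¹)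
  rw [le_inv_mul_iff₀ h0]
  exact mul_le_mul_of_nonneg_right (hl x) (hn x)

theorem lambdaOne_mul_le (R : G.Regular s h) (hu : u ∈ G.Hs s h) :
    G.lambdaOne s h * G.integral (fun x => u x ^ 2) ≤ ‖G.energyVec s h u‖ ^ 2 := by
  have hE := R.mem_energySpace hu
  have hn : ∀ x, 0 ≤ u x ^ 2 * G.μ x := fun x => mul_nonneg (sq_nonneg _) (G.μ_pos x).le
  by_cases h0 : u = 0
  · simp [h0, integral]
  obtain ⟨x, hx⟩ := Function.ne_iff.1 h0
  have hpos : 0 < G.integral fun x => u x ^ 2 :=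
    (R.summable_sq hE).tsum_pos hn x (mul_pos (by have : u x ≠ 0 := hx; positivity) (G.μ_pos x))
  rw [← le_div_iff₀ hpos, ← R.normSq_eq hE]
  refine csInf_le ⟨0, ?_⟩ ⟨u, hu, h0, rfl⟩
  rintro _ ⟨v, hv, -, rfl⟩
  rw [R.normSq_eq (R.mem_energySpace hv)]
  exact div_nonneg (sq_nonneg _)
    (tsum_nonneg fun x => mul_nonneg (sq_nonneg _) (G.μ_pos x).le)

end Regular
end WeightedGraph

/-! ### The nonlinearity on the positive half-line. -/

variable {V : Type*}

/-- The conditions on `f(x, y)` for `y ≥ 0` under which a positive ground state exists. -/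
structure Superlinear (f : V → ℝ → ℝ) (c : ℝ) : Prop where
  continuous : ∀ x, Continuous (f x)
  zero : ∀ x, f x 0 = 0
  bounded : ∀ M : ℝ, 0 < M → ∃ C : ℝ, ∀ x, ∀ y, 0 ≤ y → y ≤ M → |f x y| ≤ C
  ambrosetti_rabinowitz : ∃ α : ℝ, 2 < α ∧ ∀ x, ∀ y : ℝ, 0 < y →
    0 < α * primitive f x y ∧ α * primitive f x y ≤ y * f x y
  small : ∃ η : ℝ, 0 < η ∧ ∀ x, ∀ y, 0 < y → y < η → f x y ≤ c * y
  strictMono : ∀ x a b, 0 < a → a < b → f x a * b < f x b * a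

/-- Continuous nonlinearities that are nonnegative and locally uniformly at most quadratic. -/
structure QuadBounded (φ : V → ℝ → ℝ) : Prop where
  continuous : ∀ x, Continuous (φ x)
  nonneg : ∀ x y, 0 ≤ φ x y
  le_sq : ∀ M : ℝ, ∃ C : ℝ, 0 ≤ C ∧ ∀ x y, |y| ≤ M → φ x y ≤ C * y ^ 2

theorem primitive_zero (f : V → ℝ → ℝ) (x : V) : primitive f x 0 = 0 :=
  intervalIntegral.integral_same

namespace Superlinear

variable {f : V → ℝ → ℝ} {c : ℝ}

theorem pos (N : Superlinear f c) (x : V) {y : ℝ} (hy : 0 < y) : 0 < f x y := by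
  obtain ⟨α, -, hα⟩ := N.ambrosetti_rabinowitz
  have := (hα x y hy).1.trans_le (hα x y hy).2
  exact (mul_pos_iff_of_pos_left hy).1 this

theorem nonneg (N : Superlinear f c) (x : V) {y : ℝ} (hy : 0 ≤ y) : 0 ≤ f x y := by
  rcases hy.eq_or_lt with rfl | hy
  · exact (N.zero x).ge
  · exact (N.pos x hy).le

theorem c_pos [Nonempty V] (N : Superlinear f c) : 0 < c := by
  obtain ⟨η, hη, h⟩ := N.small
  have x : V := Classical.arbitrary V
  have h1 := h x (η / 2) (by positivity) (by linarith)
  have h2 := N.pos x (half_pos hη)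
  exact (mul_pos_iff_of_pos_right (half_pos hη)).1 (h2.trans_le h1)

/-- Below `η` the slope is at most `c`; above `η` a bound `C` is at most `(|C| / η) * y`. -/
theorem exists_linear_bound (N : Superlinear f c) (M : ℝ) :
    ∃ C : ℝ, 0 ≤ C ∧ ∀ x y, 0 ≤ y → y ≤ M → f x y ≤ C * y := by
  obtain ⟨η, hη, h⟩ := N.small
  obtain ⟨C, hC⟩ := N.bounded (max M 1) (by positivity)
  refine ⟨|c| + |C| / η, by positivity, fun x y hy hyM => ?_⟩
  rcases hy.eq_or_lt with rfl | hy0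
  · simp [N.zero]
  · rw [add_mul]
    rcases lt_or_ge y η with hyη | hyη
    · have h1 := h x y hy0 hyη
      have h2 : c * y ≤ |c| * y := mul_le_mul_of_nonneg_right (le_abs_self c) hy
      have h3 : 0 ≤ |C| / η * y := by positivity
      linarith
    · have h1 := (le_abs_self _).trans (hC x y hy (hyM.trans (le_max_left _ _)))
      have h2 : C ≤ |C| / η * y := by
        rw [div_mul_eq_mul_div, le_div_iff₀ hη]
        exact mul_le_mul (le_abs_self C) hyη hη.le (abs_nonneg C)
      have h3 : 0 ≤ |c| * y := by positivity
      linarith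

theorem mul_le_mul_of_le (N : Superlinear f c) (x : V) {a b : ℝ} (ha : 0 < a) (hab : a ≤ b) :
    f x a * b ≤ f x b * a := by
  rcases hab.eq_or_lt with rfl | h
  · exact le_rfl
  · exact (N.strictMono x a b ha h).le

theorem intervalIntegrable (N : Superlinear f c) (x : V) (a b : ℝ) :
    IntervalIntegrable (f x) MeasureTheory.volume a b :=
  (N.continuous x).intervalIntegrable a b

theorem primitive_sub (N : Superlinear f c) (x : V) (a b : ℝ) :
    primitive f x b - primitive f x a = ∫ t in a..b, f x t :=
  intervalIntegral.integral_interval_sub_left (N.intervalIntegrable x _ _)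
    (N.intervalIntegrable x _ _)

/-- The inequality behind the maximality of `J` along rays. -/
theorem le_primitive_mul_sub (N : Superlinear f c) (x : V) {y t : ℝ} (hy : 0 ≤ y) (ht : 0 < t) :
    (t ^ 2 - 1) / 2 * (f x y * y) ≤ primitive f x (t * y) - primitive f x y := by
  rcases hy.eq_or_lt with rfl | hy0
  · simp
  -- The comparison function is the line through the origin and $(y,f(x,y))$: by monotonicity of
  -- $f(x,r)/r$, $f(x,\cdot)$ lies above it to the right of $y$ and below it to the left.
  have hint : ∀ a b : ℝ, ∫ r in a..b, f x y / y * r = f x y / y * ((b ^ 2 - a ^ 2) / 2) := by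
    intro a b
    rw [intervalIntegral.integral_const_mul, integral_id]
  have hii : ∀ a b : ℝ, IntervalIntegrable (fun r => f x y / y * r) MeasureTheory.volume a b :=
    fun a b => (by fun_prop : Continuous fun r => f x y / y * r).intervalIntegrable a b
  have hval : (t ^ 2 - 1) / 2 * (f x y * y) = f x y / y * (((t * y) ^ 2 - y ^ 2) / 2) := by
    field_simp
  rw [N.primitive_sub, hval]
  rcases le_total 1 t with h1 | h1
  · rw [← hint]
    refine intervalIntegral.integral_mono_on (le_mul_of_one_le_left hy h1) (hii _ _)
      (N.intervalIntegrable x _ _) fun r hr => ?_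
    rw [div_mul_eq_mul_div, div_le_iff₀ hy0]
    exact N.mul_le_mul_of_le x hy0 hr.1
  · have h2 : ∫ r in (t * y)..y, f x r ≤ ∫ r in (t * y)..y, f x y / y * r := by
      refine intervalIntegral.integral_mono_on (mul_le_of_le_one_left hy h1)
        (N.intervalIntegrable x _ _) (hii _ _) fun r hr => ?_
      have hr0 : 0 < r := (mul_pos ht hy0).trans_le hr.1
      rw [div_mul_eq_mul_div, le_div_iff₀ hy0]
      exact N.mul_le_mul_of_le x hr0 hr.2
    rw [hint] at h2
    rw [intervalIntegral.integral_symm]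
    linarith

theorem exists_alpha (N : Superlinear f c) : ∃ α : ℝ, 2 < α ∧ ∀ x, ∀ y : ℝ, 0 ≤ y →
    0 ≤ primitive f x y ∧ α * primitive f x y ≤ f x y * y := by
  obtain ⟨α, hα2, hα⟩ := N.ambrosetti_rabinowitz
  refine ⟨α, hα2, fun x y hy => ?_⟩
  rcases hy.eq_or_lt with rfl | hy0
  · simp [primitive_zero]
  · have h1 := hα x y hy0
    rw [mul_comm (f x y)]
    exact ⟨((mul_pos_iff_of_pos_left (by linarith : 0 < α)).1 h1.1).le, h1.2⟩

theorem hasDerivAt_primitive (N : Superlinear f c) (x : V) (y : ℝ) :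
    HasDerivAt (primitive f x) (f x y) y :=
  intervalIntegral.integral_hasDerivAt_right (N.intervalIntegrable x 0 y)
    ((N.continuous x).stronglyMeasurableAtFilter _ _) (N.continuous x).continuousAt

/-- Because $f(x,0)=0$, the truncation $t\mapsto f(x,t^+)$ is continuous and vanishes for $t\le0$;
hence $y\mapsto F(x,y^+)$ is $C^1$ across $0$. -/
theorem primitive_max (N : Superlinear f c) (x : V) (y : ℝ) :
    primitive f x (max y 0) = ∫ t in (0 : ℝ)..y, f x (max t 0) := by
  rcases le_total 0 y with hy | hy
  · rw [max_eq_left hy, primitive]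
    refine intervalIntegral.integral_congr fun t ht => ?_
    rw [Set.uIcc_of_le hy] at ht
    simp only [max_eq_left ht.1]
  · rw [max_eq_right hy, primitive_zero, eq_comm]
    refine intervalIntegral.integral_zero_ae (Eventually.of_forall fun t ht => ?_)
    rw [Set.uIoc_of_ge hy] at ht
    rw [max_eq_right ht.2, N.zero]

theorem hasDerivAt_primitive_max (N : Superlinear f c) (x : V) (y : ℝ) :
    HasDerivAt (fun y => primitive f x (max y 0)) (f x (max y 0)) y := by
  have hc : Continuous fun t => f x (max t 0) :=
    (N.continuous x).comp (continuous_id.max continuous_const)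
  simp_rw [N.primitive_max x]
  exact intervalIntegral.integral_hasDerivAt_right (hc.intervalIntegrable _ _)
    (hc.stronglyMeasurableAtFilter _ _) hc.continuousAt

/-- Mean value theorem; of `ξ` only its distance to `a` is needed, to let it converge as `b` tends
to `a`. -/
theorem exists_primitive_max_sub_eq (N : Superlinear f c) (x : V) (a b : ℝ) :
    ∃ ξ : ℝ, |ξ - a| ≤ |b - a| ∧
      primitive f x (max b 0) - primitive f x (max a 0) = (b - a) * f x (max ξ 0) := by
  have hd := N.hasDerivAt_primitive_max x
  have hcont : Continuous fun y => primitive f x (max y 0) :=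
    continuous_iff_continuousAt.2 fun y => (hd y).continuousAt
  rcases lt_trichotomy a b with hab | rfl | hab
  · obtain ⟨ξ, hξ, he⟩ := exists_hasDerivAt_eq_slope _ _ hab hcont.continuousOn fun y _ => hd y
    refine ⟨ξ, ?_, ?_⟩
    · rw [abs_of_pos (sub_pos.2 hξ.1), abs_of_pos (sub_pos.2 hab)]; linarith [hξ.2]
    · rw [he, mul_div_cancel₀ _ (sub_pos.2 hab).ne']
  · exact ⟨a, by simp, by simp⟩
  · obtain ⟨ξ, hξ, he⟩ := exists_hasDerivAt_eq_slope _ _ hab hcont.continuousOn fun y _ => hd y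
    refine ⟨ξ, ?_, ?_⟩
    · rw [abs_of_neg (sub_neg.2 hξ.2), abs_of_neg (sub_neg.2 hab)]; linarith [hξ.1]
    · have := (sub_pos.2 hab).ne'
      rw [he]; field_simp; ring

/-- By (F3) $F(x,y)\,y^{-\alpha}$ is nondecreasing, so $F$ grows at least like $y^\alpha$ with
$\alpha>2$, and $yf\ge\alpha F$ transfers this to $f$. -/
theorem exists_superlinear (N : Superlinear f c) (x : V) (L : ℝ) :
    ∃ T : ℝ, 0 < T ∧ L * T ≤ f x T := by
  obtain ⟨α, hα2, hα⟩ := N.ambrosetti_rabinowitz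
  have hd : ∀ y : ℝ, 0 < y → HasDerivAt (fun y => primitive f x y * y ^ (-α))
      (f x y * y ^ (-α) + primitive f x y * (-α * y ^ (-α - 1))) y := fun y hy =>
    (N.hasDerivAt_primitive x y).mul (Real.hasDerivAt_rpow_const (Or.inl hy.ne'))
  have hmono : MonotoneOn (fun y => primitive f x y * y ^ (-α)) (Set.Ici 1) := by
    refine monotoneOn_of_deriv_nonneg (convex_Ici 1)
      (fun y hy => (hd y (one_pos.trans_le hy)).continuousAt.continuousWithinAt)
      (fun y hy => ?_) fun y hy => ?_ <;> rw [interior_Ici] at hy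
    · exact (hd y (one_pos.trans hy)).differentiableAt.differentiableWithinAt
    · have hy0 : 0 < y := one_pos.trans hy
      rw [(hd y hy0).deriv]
      have h1 : y ^ (-α) = y * y ^ (-α - 1) := by
        rw [← Real.rpow_one_add' hy0.le (by linarith)]; ring_nf
      have h2 : f x y * y ^ (-α) + primitive f x y * (-α * y ^ (-α - 1)) =
          (y * f x y - α * primitive f x y) * y ^ (-α - 1) := by rw [h1]; ring
      rw [h2]
      exact mul_nonneg (sub_nonneg.2 (hα x y hy0).2) (Real.rpow_nonneg hy0.le _)
  have h1 := hα x 1 one_pos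
  have htend : Tendsto (fun y : ℝ => α * primitive f x 1 * y ^ (α - 2)) atTop atTop :=
    (tendsto_rpow_atTop (by linarith)).const_mul_atTop h1.1
  obtain ⟨T, hT, hT1⟩ := ((htend.eventually_ge_atTop L).and (eventually_ge_atTop 1)).exists
  have hT0 : 0 < T := one_pos.trans_le hT1
  refine ⟨T, hT0, ?_⟩
  have h2 := hmono (Set.mem_Ici.2 le_rfl) (Set.mem_Ici.2 hT1) hT1
  simp only [Real.one_rpow, mul_one] at h2
  have h3 : primitive f x 1 * T ^ α ≤ primitive f x T := by
    have := mul_le_mul_of_nonneg_right h2 (Real.rpow_nonneg hT0.le α)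
    rwa [mul_assoc, ← Real.rpow_add hT0, neg_add_cancel, Real.rpow_zero, mul_one] at this
  have h4 : T ^ α = T ^ (α - 2) * T ^ 2 := by
    rw [← Real.rpow_natCast, ← Real.rpow_add hT0]; norm_num
  have h5 := (hα x T hT0).2
  have h6 : α * primitive f x 1 * T ^ (α - 2) * T ^ 2 ≤ T * f x T := by
    refine le_trans (le_of_eq ?_) ((mul_le_mul_of_nonneg_left h3 (by linarith : 0 ≤ α)).trans h5)
    rw [h4]; ring
  have h7 : L * T ^ 2 ≤ T * f x T := (mul_le_mul_of_nonneg_right hT (by positivity)).trans h6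
  refine le_of_mul_le_mul_left ?_ hT0
  linarith

theorem quadBounded_mul (N : Superlinear f c) :
    QuadBounded fun x y => f x (max y 0) * max y 0 where
  continuous x := ((N.continuous x).comp (continuous_id.max continuous_const)).mul
    (continuous_id.max continuous_const)
  nonneg x y := mul_nonneg (N.nonneg x (le_max_right _ _)) (le_max_right _ _)
  le_sq M := by
    obtain ⟨C, hC0, hC⟩ := N.exists_linear_bound (max M 0)
    refine ⟨C, hC0, fun x y hy => ?_⟩
    have h1 := hC x (max y 0) (le_max_right _ _)
      (max_le_max ((le_abs_self y).trans hy) le_rfl)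
    have h2 : (max y 0) ^ 2 ≤ y ^ 2 := by
      rcases le_total 0 y with h | h
      · rw [max_eq_left h]
      · rw [max_eq_right h, zero_pow two_ne_zero]; positivity
    calc f x (max y 0) * max y 0 ≤ C * max y 0 * max y 0 :=
          mul_le_mul_of_nonneg_right h1 (le_max_right _ _)
      _ = C * (max y 0) ^ 2 := by ring
      _ ≤ C * y ^ 2 := mul_le_mul_of_nonneg_left h2 hC0

theorem quadBounded_primitive (N : Superlinear f c) :
    QuadBounded fun x y => primitive f x (max y 0) where
  continuous x := continuous_iff_continuousAt.2 fun y =>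
    (N.hasDerivAt_primitive_max x y).continuousAt
  nonneg x y := by
    obtain ⟨α, hα2, hα⟩ := N.exists_alpha
    exact (hα x _ (le_max_right y 0)).1
  le_sq M := by
    obtain ⟨α, hα2, hα⟩ := N.exists_alpha
    obtain ⟨C, hC0, hC⟩ := N.quadBounded_mul.le_sq M
    refine ⟨C, hC0, fun x y hy => le_trans ?_ (hC x y hy)⟩
    have h1 := hα x _ (le_max_right y 0)
    nlinarith [h1.1, h1.2]

end Superlinear

theorem QuadBounded.comp_mul {φ : V → ℝ → ℝ} (hφ : QuadBounded φ) (t : ℝ) :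
    QuadBounded fun x y => φ x (t * y) where
  continuous x := (hφ.continuous x).comp (continuous_const.mul continuous_id)
  nonneg x y := hφ.nonneg x _
  le_sq M := by
    obtain ⟨C, hC0, hC⟩ := hφ.le_sq (|t| * M)
    refine ⟨C * t ^ 2, by positivity, fun x y hy => ?_⟩
    refine (hC x (t * y) ?_).trans (le_of_eq (by ring))
    rw [abs_mul]
    exact mul_le_mul_of_nonneg_left hy (abs_nonneg t)

theorem QuadBounded.zero {φ : V → ℝ → ℝ} (hφ : QuadBounded φ) (x : V) : φ x 0 = 0 := by
  obtain ⟨C, -, hC⟩ := hφ.le_sq 0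
  have h1 := hC x 0 (by simp)
  exact le_antisymm (by simpa using h1) (hφ.nonneg x 0)

/-! ### Continuity of the nonlinear integrals. -/

namespace WeightedGraph.Regular

variable {G : WeightedGraph V} {s : ℝ} {h : V → ℝ} {u v e : V → ℝ} {φ : V → ℝ → ℝ}

theorem summable_quadBounded (R : G.Regular s h) (hφ : QuadBounded φ)
    (hu : u ∈ G.energySpace s h) : Summable fun x => φ x (u x) * G.μ x := by
  obtain ⟨M, hM⟩ := R.bounded_of_mem_energySpace hu
  obtain ⟨C, hC0, hC⟩ := hφ.le_sq M
  refine Summable.of_nonneg_of_le (fun x => mul_nonneg (hφ.nonneg x _) (G.μ_pos x).le)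
    (fun x => ?_) ((R.summable_sq hu).mul_left C)
  rw [← mul_assoc]
  exact mul_le_mul_of_nonneg_right (hC x _ (hM x)) (G.μ_pos x).le

theorem tendsto_integral_quadBounded (R : G.Regular s h) (hh : Tendsto h cofinite atTop)
    (hφ : QuadBounded φ) {u : ℕ → V → ℝ} (hu : ∀ n, u n ∈ G.Hs s h) {C : ℝ}
    (hC : ∀ n, ‖G.energyVec s h (u n)‖ ≤ C)
    (hv : ∀ x, Tendsto (fun n => u n x) atTop (𝓝 (v x))) :
    Tendsto (fun n => G.integral fun x => φ x (u n x)) atTop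
      (𝓝 (G.integral fun x => φ x (v x))) := by
  obtain ⟨κ, hκ0, hκ⟩ := R.exists_sup_bound
  have hu' := fun n => R.mem_energySpace (hu n)
  obtain ⟨D, hD0, hD⟩ := hφ.le_sq (κ * C)
  refine tendsto_tsum_of_coercive hh R.h_lower (C := D * C ^ 2)
    (fun n x => mul_nonneg (hφ.nonneg x _) (G.μ_pos x).le) (fun n S => ?_) fun x =>
    (((hφ.continuous x).tendsto _).comp (hv x)).mul_const _
  have h1 := R.sum_potential_le (hu' n) S
  have h2 : ‖G.energyVec s h (u n)‖ ^ 2 ≤ C ^ 2 := pow_le_pow_left₀ (norm_nonneg _) (hC n) 2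
  refine le_trans ?_ (mul_le_mul_of_nonneg_left (h1.trans h2) hD0)
  rw [Finset.mul_sum]
  refine Finset.sum_le_sum fun x _ => ?_
  have h3 := hD x (u n x) ((hκ _ (hu' n) x).trans (mul_le_mul_of_nonneg_left (hC n) hκ0.le))
  have h4 := mul_le_mul_of_nonneg_left h3 (mul_nonneg (R.h_pos x).le (G.μ_pos x).le)
  linarith

/-- The two parameters are the rescaling and the size of the perturbation. Convergent parameters
give norm-bounded, pointwise convergent functions. -/
theorem continuous_integral_quadBounded (R : G.Regular s h) (hh : Tendsto h cofinite atTop)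
    (hφ : QuadBounded φ) (hu : u ∈ G.Hs s h) (he : e ∈ G.Hs s h) :
    Continuous fun p : ℝ × ℝ => G.integral fun x => φ x ((p.1 • (u + p.2 • e)) x) := by
  refine continuous_iff_seqContinuous.2 fun p q hpq => ?_
  have hu' := R.mem_energySpace hu
  have he' := R.mem_energySpace he
  have h1 : Continuous fun p : ℝ × ℝ => p.1 • (G.energyVec s h u + p.2 • G.energyVec s h e) := by
    fun_prop
  have h2 : ∀ n, (p n).1 • (G.energyVec s h u + (p n).2 • G.energyVec s h e)
      = G.energyVec s h ((p n).1 • (u + (p n).2 • e)) := fun n => by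
    rw [energyVec_smul _ (add_mem hu' (Submodule.smul_mem _ _ he')),
      energyVec_add hu' (Submodule.smul_mem _ _ he'), energyVec_smul _ he']
  obtain ⟨C, hC⟩ := ((h1.tendsto q).comp hpq).norm.bddAbove_range
  refine R.tendsto_integral_quadBounded hh hφ
    (fun n => R.smul_mem_Hs _ (R.add_mem_Hs hu (R.smul_mem_Hs _ he))) (C := C) (fun n => ?_)
    fun x => ?_
  · rw [← h2]
    exact hC ⟨n, rfl⟩
  · have h3 : Continuous fun p : ℝ × ℝ => (p.1 • (u + p.2 • e)) x := by
      simp only [Pi.smul_apply, Pi.add_apply, smul_eq_mul]; fun_prop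
    exact (h3.tendsto q).comp hpq

end WeightedGraph.Regular

theorem max_mul_zero {t : ℝ} (ht : 0 ≤ t) (y : ℝ) : max (t * y) 0 = t * max y 0 := by
  rw [← mul_zero t, ← mul_max_of_nonneg _ _ ht, mul_zero]

/-! ### The Nehari manifold and the minimizer. -/

namespace WeightedGraph

/-- The functional `∫_V f(x,u⁺) u⁺ dμ`. -/
def nehariTerm (G : WeightedGraph V) (f : V → ℝ → ℝ) (u : V → ℝ) : ℝ :=
  G.integral fun x => f x (max (u x) 0) * max (u x) 0

/-- The functional `∫_V F(x,u⁺) dμ`. -/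
def primitiveTerm (G : WeightedGraph V) (f : V → ℝ → ℝ) (u : V → ℝ) : ℝ :=
  G.integral fun x => primitive f x (max (u x) 0)

namespace Regular

variable {G : WeightedGraph V} {s : ℝ} {h : V → ℝ} {u v e : V → ℝ} {f : V → ℝ → ℝ} {c : ℝ}

theorem energyPos_eq (R : G.Regular s h) (hu : u ∈ G.Hs s h) :
    G.energyPos s h f u = 1 / 2 * ‖G.energyVec s h u‖ ^ 2 - G.primitiveTerm f u := by
  rw [energyPos, R.normSq_eq (R.mem_energySpace hu), primitiveTerm]

theorem mem_nehariPos_iff (R : G.Regular s h) : u ∈ G.nehariPos s h f ↔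
    u ∈ G.Hs s h ∧ u ≠ 0 ∧ ‖G.energyVec s h u‖ ^ 2 = G.nehariTerm f u := by
  refine and_congr_right fun hu => and_congr_right fun _ => ?_
  rw [R.normSq_eq (R.mem_energySpace hu), nehariTerm]

theorem summable_nehariTerm (R : G.Regular s h) (N : Superlinear f c) (hu : u ∈ G.Hs s h) :
    Summable fun x => f x (max (u x) 0) * max (u x) 0 * G.μ x :=
  R.summable_quadBounded (φ := fun x y => f x (max y 0) * max y 0) N.quadBounded_mul
    (R.mem_energySpace hu)

theorem summable_primitiveTerm (R : G.Regular s h) (N : Superlinear f c) (hu : u ∈ G.Hs s h) :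
    Summable fun x => primitive f x (max (u x) 0) * G.μ x :=
  R.summable_quadBounded (φ := fun x y => primitive f x (max y 0)) N.quadBounded_primitive
    (R.mem_energySpace hu)

theorem mul_primitiveTerm_le (R : G.Regular s h) (N : Superlinear f c) :
    ∃ α : ℝ, 2 < α ∧ ∀ u ∈ G.Hs s h, α * G.primitiveTerm f u ≤ G.nehariTerm f u := by
  obtain ⟨α, hα2, hα⟩ := N.exists_alpha
  refine ⟨α, hα2, fun u hu => ?_⟩
  rw [primitiveTerm, integral, ← tsum_mul_left]
  refine ((R.summable_primitiveTerm N hu).mul_left α).tsum_le_tsum (fun x => ?_)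
    (R.summable_nehariTerm N hu)
  rw [← mul_assoc]
  exact mul_le_mul_of_nonneg_right (hα x _ (le_max_right _ _)).2 (G.μ_pos x).le

theorem norm_energyVec_pos (R : G.Regular s h) (hu : u ∈ G.Hs s h) (h0 : u ≠ 0) :
    0 < ‖G.energyVec s h u‖ := by
  obtain ⟨κ, hκ0, hκ⟩ := R.exists_sup_bound
  obtain ⟨x, hx⟩ := Function.ne_iff.1 h0
  have h1 := hκ u (R.mem_energySpace hu) x
  have h2 : 0 < |u x| := abs_pos.2 hx
  exact (mul_pos_iff_of_pos_left hκ0).1 (h2.trans_le h1)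

theorem norm_energyVec_smul (R : G.Regular s h) (t : ℝ) (hu : u ∈ G.Hs s h) :
    ‖G.energyVec s h (t • u)‖ ^ 2 = t ^ 2 * ‖G.energyVec s h u‖ ^ 2 := by
  rw [energyVec_smul t (R.mem_energySpace hu), norm_smul, mul_pow, Real.norm_eq_abs, sq_abs]

/-- Functions that are small from above lie strictly inside the Nehari manifold. -/
theorem nehariTerm_lt (R : G.Regular s h) [Nonempty V] (N : Superlinear f c)
    (hc : c < G.lambdaOne s h) :
    ∃ η : ℝ, 0 < η ∧ ∀ u ∈ G.Hs s h, u ≠ 0 → (∀ x, u x < η) →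
      G.nehariTerm f u < ‖G.energyVec s h u‖ ^ 2 := by
  obtain ⟨η, hη, hsmall⟩ := N.small
  refine ⟨η, hη, fun u hu h0 hlt => ?_⟩
  have hE := R.mem_energySpace hu
  have hn : ∀ x, 0 ≤ u x ^ 2 * G.μ x := fun x => mul_nonneg (sq_nonneg _) (G.μ_pos x).le
  obtain ⟨x, hx⟩ := Function.ne_iff.1 h0
  have hpos : 0 < G.integral fun x => u x ^ 2 :=
    (R.summable_sq hE).tsum_pos hn x (mul_pos (by have : u x ≠ 0 := hx; positivity) (G.μ_pos x))
  have h1 : G.nehariTerm f u ≤ c * G.integral fun x => u x ^ 2 := by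
    rw [nehariTerm, integral, integral, ← tsum_mul_left]
    refine (R.summable_nehariTerm N hu).tsum_le_tsum (fun x => ?_) ((R.summable_sq hE).mul_left c)
    rw [← mul_assoc]
    refine mul_le_mul_of_nonneg_right ?_ (G.μ_pos x).le
    rcases lt_or_ge 0 (u x) with hx | hx
    · rw [max_eq_left hx.le]
      have := mul_le_mul_of_nonneg_right (hsmall x _ hx (hlt x)) hx.le
      linarith
    · rw [max_eq_right hx, mul_zero]
      exact mul_nonneg N.c_pos.le (sq_nonneg _)
  -- $B(u)\le c\int u^2<\lambda_1\int u^2\le\|u\|^2$.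
  exact h1.trans_lt ((mul_lt_mul_of_pos_right hc hpos).trans_le (R.lambdaOne_mul_le hu))

theorem exists_nehari_lower_bound (R : G.Regular s h) [Nonempty V] (N : Superlinear f c)
    (hc : c < G.lambdaOne s h) :
    ∃ δ : ℝ, 0 < δ ∧ ∀ u ∈ G.nehariPos s h f, δ ≤ ‖G.energyVec s h u‖ ^ 2 := by
  obtain ⟨η, hη, H⟩ := R.nehariTerm_lt N hc
  obtain ⟨κ, hκ0, hκ⟩ := R.exists_sup_bound
  -- A norm below `η / κ` forces `u < η` everywhere, where the Nehari identity fails strictly.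
  refine ⟨(η / κ) ^ 2, by positivity, fun u hu => ?_⟩
  obtain ⟨hu, h0, heq⟩ := R.mem_nehariPos_iff.1 hu
  by_contra hlt
  refine (H u hu h0 fun x => ?_).ne heq.symm
  have h1 := lt_of_pow_lt_pow_left₀ 2 (by positivity) (not_le.1 hlt)
  refine (le_abs_self _).trans_lt ((hκ u (R.mem_energySpace hu) x).trans_lt ?_)
  rw [lt_div_iff₀ hκ0] at h1
  linarith

theorem exists_mem_nehari_of_le (R : G.Regular s h) (hh : Tendsto h cofinite atTop)
    (N : Superlinear f c) (hu : u ∈ G.Hs s h) {a b : ℝ} (hab : a ≤ b)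
    (ha : G.nehariTerm f (a • u) ≤ a ^ 2 * ‖G.energyVec s h u‖ ^ 2)
    (hb : b ^ 2 * ‖G.energyVec s h u‖ ^ 2 ≤ G.nehariTerm f (b • u)) :
    ∃ t ∈ Set.Icc a b, t ^ 2 * ‖G.energyVec s h u‖ ^ 2 = G.nehariTerm f (t • u) := by
  have h1 : Continuous fun t : ℝ => G.nehariTerm f (t • u) := by
    have h2 := (R.continuous_integral_quadBounded hh N.quadBounded_mul hu hu).comp
      (by fun_prop : Continuous fun t : ℝ => (t, (0 : ℝ)))
    simpa [Function.comp_def, nehariTerm] using h2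
  have h3 : ContinuousOn
      (fun t : ℝ => G.nehariTerm f (t • u) - t ^ 2 * ‖G.energyVec s h u‖ ^ 2) (Set.Icc a b) := by
    fun_prop
  obtain ⟨t, ht, h0⟩ := intermediate_value_Icc hab h3
    (⟨sub_nonpos.2 ha, sub_nonneg.2 hb⟩ : (0 : ℝ) ∈ Set.Icc _ _)
  exact ⟨t, ht, (sub_eq_zero.1 h0).symm⟩

theorem smul_mem_nehariPos (R : G.Regular s h) (hu : u ∈ G.Hs s h) (h0 : u ≠ 0) {t : ℝ}
    (ht : t ≠ 0) (heq : t ^ 2 * ‖G.energyVec s h u‖ ^ 2 = G.nehariTerm f (t • u)) :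
    t • u ∈ G.nehariPos s h f :=
  R.mem_nehariPos_iff.2 ⟨R.smul_mem_Hs t hu, smul_ne_zero ht h0, by
    rw [R.norm_energyVec_smul t hu, heq]⟩

theorem nehariTerm_smul_lt (R : G.Regular s h) [Nonempty V] (N : Superlinear f c)
    (hc : c < G.lambdaOne s h) (hu : u ∈ G.Hs s h) (h0 : u ≠ 0) {b : ℝ} (hb : 0 < b) :
    ∃ a, 0 < a ∧ a ≤ b ∧ G.nehariTerm f (a • u) < a ^ 2 * ‖G.energyVec s h u‖ ^ 2 := by
  obtain ⟨η, hη, H⟩ := R.nehariTerm_lt N hc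
  obtain ⟨M, hM⟩ := R.bounded_of_mem_energySpace (R.mem_energySpace hu)
  have hM0 : 0 < |M| + 1 := by positivity
  refine ⟨min b (η / (|M| + 1)), by positivity, min_le_left _ _, ?_⟩
  set a := min b (η / (|M| + 1)) with ha
  have ha0 : 0 < a := by positivity
  rw [← R.norm_energyVec_smul a hu]
  refine H _ (R.smul_mem_Hs a hu) (smul_ne_zero ha0.ne' h0) fun x => ?_
  have h1 : a * (|M| + 1) ≤ η := (le_div_iff₀ hM0).1 (min_le_right _ _)
  have h2 : u x < |M| + 1 := by
    linarith [le_abs_self (u x), hM x, le_abs_self M]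
  exact (mul_lt_mul_of_pos_left h2 ha0).trans_le h1

/-- On the ray of a point mass, the quadratic term dominates near $0$ and superlinearity wins far
out, so the ray crosses the manifold. -/
theorem nehariPos_nonempty (R : G.Regular s h) [Nonempty V] (hh : Tendsto h cofinite atTop)
    (N : Superlinear f c) (hc : c < G.lambdaOne s h) : (G.nehariPos s h f).Nonempty := by
  classical
  have z : V := Classical.arbitrary V
  have he := R.single_mem_Hs z
  have h0 : (Pi.single z 1 : V → ℝ) ≠ 0 := by simp
  obtain ⟨T, hT0, hT⟩ := N.exists_superlinear z (‖G.energyVec s h (Pi.single z 1)‖ ^ 2 / G.μ z)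
  obtain ⟨a, ha0, hab, ha⟩ := R.nehariTerm_smul_lt N hc he h0 hT0
  have hval : G.nehariTerm f (T • (Pi.single z 1 : V → ℝ)) = f z T * T * G.μ z := by
    rw [nehariTerm, integral, tsum_eq_single z]
    · simp [hT0.le]
    · intro x hx; simp [hx]
  obtain ⟨t, ht, heq⟩ := R.exists_mem_nehari_of_le hh N he hab ha.le (by
    rw [hval]
    have h1 := mul_le_mul_of_nonneg_right hT (mul_nonneg hT0.le (G.μ_pos z).le)
    have := (G.μ_pos z).ne'
    refine le_trans (le_of_eq ?_) (h1.trans (le_of_eq ?_))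
    · field_simp
    · ring)
  exact ⟨_, R.smul_mem_nehariPos he h0 (ha0.trans_le ht.1).ne' heq⟩

theorem primitiveTerm_smul_ge (R : G.Regular s h) (N : Superlinear f c) (hu : u ∈ G.Hs s h)
    {t : ℝ} (ht : 0 < t) :
    (t ^ 2 - 1) / 2 * G.nehariTerm f u ≤ G.primitiveTerm f (t • u) - G.primitiveTerm f u := by
  have h1 := R.summable_primitiveTerm N (R.smul_mem_Hs t hu)
  have h2 := R.summable_primitiveTerm N hu
  rw [primitiveTerm, primitiveTerm, integral, integral, ← h1.tsum_sub h2, nehariTerm, integral,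
    ← tsum_mul_left]
  refine ((R.summable_nehariTerm N hu).mul_left _).tsum_le_tsum (fun x => ?_) (h1.sub h2)
  have h3 := mul_le_mul_of_nonneg_right
    (N.le_primitive_mul_sub x (le_max_right (u x) 0) ht) (G.μ_pos x).le
  simp only [Pi.smul_apply, smul_eq_mul, max_mul_zero ht.le]
  linarith

/-- An element of the Nehari manifold maximizes the energy on its ray. -/
theorem energyPos_smul_le (R : G.Regular s h) (N : Superlinear f c)
    (hu : u ∈ G.nehariPos s h f) {t : ℝ} (ht : 0 < t) :
    G.energyPos s h f (t • u) ≤ G.energyPos s h f u := by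
  obtain ⟨hu, -, heq⟩ := R.mem_nehariPos_iff.1 hu
  rw [R.energyPos_eq hu, R.energyPos_eq (R.smul_mem_Hs t hu), R.norm_energyVec_smul t hu]
  -- With $B(u)=\|u\|^2$, the growth of $F$ along the ray is at least the change
  -- $\frac{t^2-1}2\|u\|^2$ of the quadratic part.
  have := R.primitiveTerm_smul_ge N hu ht
  rw [← heq] at this
  linarith

/-- The energy attains its infimum on the Nehari manifold. -/
theorem exists_minimizer (R : G.Regular s h) [Nonempty V] [Countable V]
    (hh : Tendsto h cofinite atTop) (N : Superlinear f c) (hc : c < G.lambdaOne s h) :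
    ∃ u ∈ G.nehariPos s h f, ∀ v ∈ G.nehariPos s h f,
      G.energyPos s h f u ≤ G.energyPos s h f v := by
  obtain ⟨α, hα2, hα⟩ := R.mul_primitiveTerm_le N
  have hlow : ∀ u ∈ G.nehariPos s h f,
      (1 / 2 - 1 / α) * ‖G.energyVec s h u‖ ^ 2 ≤ G.energyPos s h f u := fun u hu => by
    obtain ⟨hu, -, heq⟩ := R.mem_nehariPos_iff.1 hu
    rw [R.energyPos_eq hu]
    have h1 := hα u hu
    rw [← heq, mul_comm, ← le_div_iff₀ (by linarith)] at h1
    have h2 : 1 / α * ‖G.energyVec s h u‖ ^ 2 = ‖G.energyVec s h u‖ ^ 2 / α := by ring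
    linarith
  have hβ : 0 < 1 / 2 - 1 / α := sub_pos.2 (one_div_lt_one_div_of_lt two_pos hα2)
  set E := G.energyPos s h f '' G.nehariPos s h f
  have hEne : E.Nonempty := (R.nehariPos_nonempty hh N hc).image _
  have hEb : BddBelow E := ⟨0, by
    rintro _ ⟨u, hu, rfl⟩
    exact (by positivity : (0 : ℝ) ≤ _).trans (hlow u hu)⟩
  obtain ⟨r, -, hr, hrE⟩ := exists_seq_tendsto_sInf hEne hEb
  choose u hu hur using hrE
  obtain ⟨D, hD⟩ := hr.bddAbove_range
  have huH := fun n => (R.mem_nehariPos_iff.1 (hu n)).1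
  have hnorm : ∀ n, ‖G.energyVec s h (u n)‖ ≤ √(D / (1 / 2 - 1 / α)) := fun n => by
    refine Real.le_sqrt_of_sq_le ?_
    rw [le_div_iff₀ hβ, mul_comm]
    exact (hlow _ (hu n)).trans ((hur n).le.trans (hD ⟨n, rfl⟩))
  obtain ⟨κ, hκ0, hκ⟩ := R.exists_sup_bound
  obtain ⟨v, σ, hσ, hv⟩ := exists_subseq_tendsto_pi (u := u)
    (M := κ * √(D / (1 / 2 - 1 / α))) fun n x =>
    (hκ _ (R.mem_energySpace (huH n)) x).trans (mul_le_mul_of_nonneg_left (hnorm n) hκ0.le)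
  have hvH : v ∈ G.Hs s h := R.mem_Hs_of_tendsto (fun n => huH (σ n)) (fun n => hnorm (σ n)) hv
  -- On the manifold the squared norms equal $B(u_n)$, so they converge, but to $B(v)$: the norm of
  -- `v` itself may be smaller.
  have hB : Tendsto (fun n => ‖G.energyVec s h (u (σ n))‖ ^ 2) atTop (𝓝 (G.nehariTerm f v)) := by
    refine (R.tendsto_integral_quadBounded hh N.quadBounded_mul (fun n => huH (σ n))
      (fun n => hnorm (σ n)) hv).congr fun n => ?_
    exact (R.mem_nehariPos_iff.1 (hu (σ n))).2.2.symm
  have hle : ‖G.energyVec s h v‖ ^ 2 ≤ G.nehariTerm f v :=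
    R.norm_energyVec_le_of_tendsto (fun n => huH (σ n)) hvH hB hv
  obtain ⟨δ, hδ0, hδ⟩ := R.exists_nehari_lower_bound N hc
  have hBpos : 0 < G.nehariTerm f v :=
    hδ0.trans_le (ge_of_tendsto' hB fun n => hδ _ (hu (σ n)))
  have hv0 : v ≠ 0 := by
    rintro rfl
    simp [nehariTerm, integral] at hBpos
  -- The possible loss of norm is repaired by projecting `v` along its ray with a factor in `[a,
  -- 1]`.
  obtain ⟨a, ha0, ha1, ha⟩ := R.nehariTerm_smul_lt N hc hvH hv0 one_pos
  obtain ⟨t, ht, heq⟩ := R.exists_mem_nehari_of_le hh N hvH ha1 ha.le (by simpa using hle)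
  have ht0 : 0 < t := ha0.trans_le ht.1
  have htv := R.smul_mem_nehariPos hvH hv0 ht0.ne' heq
  refine ⟨t • v, htv, fun w hw => le_trans ?_ (csInf_le hEb ⟨w, hw, rfl⟩)⟩
  have hΦ : Tendsto (fun n => G.primitiveTerm f (t • u (σ n))) atTop
      (𝓝 (G.primitiveTerm f (t • v))) :=
    R.tendsto_integral_quadBounded hh (N.quadBounded_primitive.comp_mul t)
      (fun n => huH (σ n)) (fun n => hnorm (σ n)) hv
  have hlim := ((hB.const_mul (t ^ 2)).const_mul (1 / 2)).sub hΦ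
  -- The limit of $J_+(tu_n)\le J_+(u_n)$, at the fixed scale `t` of the limit function.
  have h1 : 1 / 2 * (t ^ 2 * G.nehariTerm f v) - G.primitiveTerm f (t • v) ≤ sInf E := by
    refine le_of_tendsto_of_tendsto' hlim (hr.comp hσ.tendsto_atTop) fun n => ?_
    have h2 := R.energyPos_smul_le N (hu (σ n)) ht0
    rw [R.energyPos_eq (R.smul_mem_Hs t (huH _)), R.norm_energyVec_smul t (huH _), hur] at h2
    exact h2
  refine le_trans ?_ h1
  rw [R.energyPos_eq (R.smul_mem_Hs t hvH), R.norm_energyVec_smul t hvH]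
  have := mul_le_mul_of_nonneg_left hle (sq_nonneg t)
  linarith

end Regular
end WeightedGraph

/-! ### Euler–Lagrange equation, positivity and weak form. -/

namespace WeightedGraph.Regular

variable {G : WeightedGraph V} {s : ℝ} {h : V → ℝ} {u v e : V → ℝ} {f : V → ℝ → ℝ}
  {c : ℝ}

theorem exists_pos_of_mem_nehariPos (R : G.Regular s h)
    (hu : u ∈ G.nehariPos s h f) : ∃ x, 0 < u x := by
  obtain ⟨hu, h0, heq⟩ := R.mem_nehariPos_iff.1 hu
  by_contra! hneg
  have h1 := R.norm_energyVec_pos hu h0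
  have h2 : G.nehariTerm f u = 0 := by
    simp [nehariTerm, integral, max_eq_right (hneg _)]
  rw [h2] at heq
  exact (pow_pos h1 2).ne' heq

/-- Cross-multiplied form of strict growth of $B(tu)/t^2$. It makes rays cross the manifold with
strict inequalities on both sides, which replaces differentiability. -/
theorem nehariTerm_strictMono (R : G.Regular s h) (N : Superlinear f c) (hu : u ∈ G.Hs s h)
    (hpos : ∃ x, 0 < u x) {a b : ℝ} (ha : 0 < a) (hab : a < b) :
    b ^ 2 * G.nehariTerm f (a • u) < a ^ 2 * G.nehariTerm f (b • u) := by
  have hb : 0 < b := ha.trans hab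
  rw [nehariTerm, nehariTerm, integral, integral, ← tsum_mul_left, ← tsum_mul_left]
  have key : ∀ x, 0 < u x → b ^ 2 * (f x (max ((a • u) x) 0) * max ((a • u) x) 0 * G.μ x) <
      a ^ 2 * (f x (max ((b • u) x) 0) * max ((b • u) x) 0 * G.μ x) := fun x hx => by
    simp only [Pi.smul_apply, smul_eq_mul, max_mul_zero ha.le, max_mul_zero hb.le,
      max_eq_left hx.le]
    have h1 := N.strictMono x (a * u x) (b * u x) (by positivity)
      (mul_lt_mul_of_pos_right hab hx)
    have h2 := mul_lt_mul_of_pos_right h1 (mul_pos (mul_pos ha hb) (G.μ_pos x))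
    linarith
  obtain ⟨x, hx⟩ := hpos
  refine Summable.tsum_lt_tsum (i := x) (fun y => ?_) (key x hx)
    ((R.summable_nehariTerm N (R.smul_mem_Hs a hu)).mul_left _)
    ((R.summable_nehariTerm N (R.smul_mem_Hs b hu)).mul_left _)
  rcases lt_or_ge 0 (u y) with hy | hy
  · exact (key y hy).le
  · simp only [Pi.smul_apply, smul_eq_mul, max_mul_zero ha.le, max_mul_zero hb.le,
      max_eq_right hy]
    simp

/-- Small perturbations of an element of the Nehari manifold return to it under a rescaling by a
factor close to one. -/
theorem eventually_exists_smul_mem (R : G.Regular s h) (hh : Tendsto h cofinite atTop)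
    (N : Superlinear f c) (hu : u ∈ G.nehariPos s h f) (he : e ∈ G.Hs s h) {δ : ℝ} (hδ0 : 0 < δ)
    (hδ1 : δ < 1) :
    ∀ᶠ ε : ℝ in 𝓝 0, ∃ t ∈ Set.Icc (1 - δ) (1 + δ), t • (u + ε • e) ∈ G.nehariPos s h f := by
  have hpos := R.exists_pos_of_mem_nehariPos hu
  obtain ⟨hu, h0, heq⟩ := R.mem_nehariPos_iff.1 hu
  have hu' := R.mem_energySpace hu
  have he' := R.mem_energySpace he
  have hB : ∀ t : ℝ, Continuous fun ε : ℝ => G.nehariTerm f (t • (u + ε • e)) := fun t =>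
    (R.continuous_integral_quadBounded hh N.quadBounded_mul hu he).comp
      (by fun_prop : Continuous fun ε : ℝ => (t, ε))
  have hn : ∀ ε : ℝ, G.energyVec s h (u + ε • e) =
      G.energyVec s h u + ε • G.energyVec s h e := fun ε => by
    rw [energyVec_add hu' (Submodule.smul_mem _ _ he'), energyVec_smul _ he']
  have hQ : Continuous fun ε : ℝ => ‖G.energyVec s h (u + ε • e)‖ ^ 2 := by
    simp_rw [hn]; fun_prop
  -- The strict inequalities at the scales `1 - δ` and `1 + δ` hold for `ε = 0` and persist for
  -- small `ε`; a crossing lies between.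
  have e1 : ∀ᶠ ε : ℝ in 𝓝 0, G.nehariTerm f ((1 - δ) • (u + ε • e)) <
      (1 - δ) ^ 2 * ‖G.energyVec s h (u + ε • e)‖ ^ 2 := by
    refine (hB _).continuousAt.eventually_lt (continuous_const.mul hQ).continuousAt ?_
    have := R.nehariTerm_strictMono N hu hpos (a := 1 - δ) (b := 1) (by linarith) (by linarith)
    simpa [heq] using this
  have e2 : ∀ᶠ ε : ℝ in 𝓝 0, (1 + δ) ^ 2 * ‖G.energyVec s h (u + ε • e)‖ ^ 2 <
      G.nehariTerm f ((1 + δ) • (u + ε • e)) := by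
    refine (continuous_const.mul hQ).continuousAt.eventually_lt (hB _).continuousAt ?_
    have := R.nehariTerm_strictMono N hu hpos (a := 1) (b := 1 + δ) (by linarith) (by linarith)
    simpa [heq] using this
  have e3 : ∀ᶠ ε : ℝ in 𝓝 0, 0 < ‖G.energyVec s h (u + ε • e)‖ ^ 2 := by
    refine continuous_const.continuousAt.eventually_lt hQ.continuousAt ?_
    simpa using pow_pos (R.norm_energyVec_pos hu h0) 2
  filter_upwards [e1, e2, e3] with ε h1 h2 h3
  have hw : u + ε • e ∈ G.Hs s h := R.add_mem_Hs hu (R.smul_mem_Hs ε he)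
  have hw0 : u + ε • e ≠ 0 := fun hzero => by
    have h4 := R.norm_energyVec_smul 0 hu
    rw [zero_smul] at h4
    rw [hzero, h4] at h3
    simp at h3
  obtain ⟨t, ht, hteq⟩ := R.exists_mem_nehari_of_le hh N hw (by linarith) h1.le h2.le
  have ht0 : 0 < t := by linarith [ht.1]
  exact ⟨t, ht, R.smul_mem_nehariPos hw hw0 ht0.ne' hteq⟩

theorem primitiveTerm_add_single [DecidableEq V] (R : G.Regular s h) (N : Superlinear f c)
    (hu : u ∈ G.Hs s h) (z : V) (a : ℝ) :
    G.primitiveTerm f (u + a • (Pi.single z 1 : V → ℝ)) - G.primitiveTerm f u =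
      (primitive f z (max (u z + a) 0) - primitive f z (max (u z) 0)) * G.μ z := by
  have h1 := R.summable_primitiveTerm N (R.add_mem_Hs hu (R.smul_mem_Hs a (R.single_mem_Hs z)))
  have h2 := R.summable_primitiveTerm N hu
  rw [primitiveTerm, primitiveTerm, integral, integral, ← h1.tsum_sub h2, tsum_eq_single z]
  · simp [sub_mul]
  · intro x hx; simp [hx]

/-- One-sided first variation in the direction $\tau\delta_z$. Comparing with $tu$ rather than $u$
removes the dependence of the rescaling factor $t$ on the perturbation: only $t\to1$ matters, not
its rate. -/
theorem sign_mul_nonneg_of_minimizer (R : G.Regular s h) (hh : Tendsto h cofinite atTop)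
    (N : Superlinear f c) (hu : u ∈ G.nehariPos s h f)
    (hmin : ∀ v ∈ G.nehariPos s h f, G.energyPos s h f u ≤ G.energyPos s h f v) (z : V) {τ : ℝ}
    (hτ : |τ| = 1) :
    0 ≤ τ * (G.fracLaplacian s u z + h z * u z - f z (max (u z) 0)) := by
  classical
  have huN := hu
  obtain ⟨hu, -, -⟩ := R.mem_nehariPos_iff.1 hu
  have hu' := R.mem_energySpace hu
  have he := R.single_mem_Hs z
  have he' := R.mem_energySpace he
  set e : V → ℝ := Pi.single z 1
  set I := inner ℝ (G.energyVec s h u) (G.energyVec s h e) with hI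
  have hIval : I = (G.fracLaplacian s u z + h z * u z) * G.μ z := R.inner_single hu' z
  by_contra! hneg
  set Q := ‖G.energyVec s h e‖ ^ 2
  -- With perturbation $\tau r$ and mean value point $\xi$, the energy difference is
  -- $tr\,\Psi(t,\tau r,\xi)$, while $\Psi(1,0,u(z))$ is $\tau\mu(z)$ times the residual at $z$.
  let Ψ : ℝ × ℝ × ℝ → ℝ := fun p =>
    τ * (p.1 * I + 1 / 2 * (p.1 * p.2.1) * Q - f z (max p.2.2 0) * G.μ z)
  have hΨ : Continuous Ψ := by
    have := (N.continuous z).comp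
      (by fun_prop : Continuous fun p : ℝ × ℝ × ℝ => max p.2.2 0)
    have h1 : Continuous fun p : ℝ × ℝ × ℝ => p.1 * I + 1 / 2 * (p.1 * p.2.1) * Q :=
      (continuous_fst.mul continuous_const).add
        ((continuous_const.mul (continuous_fst.mul continuous_snd.fst)).mul continuous_const)
    exact continuous_const.mul (h1.sub (this.mul continuous_const))
  have hΨ0 : Ψ (1, 0, u z) < 0 := by
    have := mul_neg_of_neg_of_pos hneg (G.μ_pos z)
    simp only [Ψ, hIval]
    linarith
  obtain ⟨ρ, hρ0, hρ⟩ := Metric.eventually_nhds_iff.1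
    (hΨ.continuousAt.eventually_lt continuousAt_const hΨ0)
  -- Ensures $|tu(z)-u(z)|\le\rho/2$; together with $|\xi-tu(z)|\le2r\le\rho/4$ this keeps $\xi$
  -- within $\rho$ of $u(z)$.
  set δ := min (1 / 2) (ρ / (2 * (|u z| + 1))) with hδ
  have hδ0 : 0 < δ := by positivity
  have hδ2 : δ ≤ 1 / 2 := min_le_left _ _
  have hδρ : δ * (|u z| + 1) ≤ ρ / 2 := by
    have h1 : δ ≤ ρ / (2 * (|u z| + 1)) := min_le_right _ _
    rw [le_div_iff₀ (by positivity)] at h1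
    linarith
  obtain ⟨ρ', hρ'0, hρ'⟩ := Metric.eventually_nhds_iff.1
    (R.eventually_exists_smul_mem hh N huN he hδ0 (by linarith))
  set r := min (ρ' / 2) (ρ / 8) with hr
  have hr0 : 0 < r := by positivity
  have hrρ' : r < ρ' := (min_le_left _ _).trans_lt (by linarith)
  have hrρ : r ≤ ρ / 8 := min_le_right _ _
  obtain ⟨t, ht, htN⟩ := hρ' (y := τ * r) (by
    rw [Real.dist_eq, sub_zero, abs_mul, hτ, one_mul, abs_of_pos hr0]; exact hrρ')
  have ht0 : 0 < t := by linarith [ht.1]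
  have ht2 : t ≤ 2 := by linarith [ht.2]
  have htu := R.smul_mem_Hs t hu
  have hsplit : t • (u + (τ * r) • e) = t • u + (t * (τ * r)) • e := by
    rw [smul_add, smul_smul]
  have h1 : G.energyPos s h f (t • u) ≤ G.energyPos s h f (t • u + (t * (τ * r)) • e) :=
    (R.energyPos_smul_le N huN ht0).trans (by rw [← hsplit]; exact hmin _ htN)
  have h2 := R.primitiveTerm_add_single N htu z (t * (τ * r))
  obtain ⟨ξ, hξ, hξeq⟩ := N.exists_primitive_max_sub_eq z (t * u z) (t * u z + t * (τ * r))
  rw [add_sub_cancel_left] at hξ hξeq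
  rw [Pi.smul_apply, smul_eq_mul, hξeq] at h2
  rw [R.energyPos_eq htu, R.energyPos_eq (R.add_mem_Hs htu (R.smul_mem_Hs _ he)),
    energyVec_add (Submodule.smul_mem _ t hu') (Submodule.smul_mem _ _ he'),
    energyVec_smul _ hu', energyVec_smul _ he', norm_add_sq_real, real_inner_smul_left,
    real_inner_smul_right, norm_smul (t * (τ * r)), mul_pow, Real.norm_eq_abs, sq_abs] at h1
  have hτ2 : τ * τ = 1 := by rw [← abs_mul_abs_self, hτ, one_mul]
  have h3 : 0 ≤ (t * r) * Ψ (t, t * 0 + τ * r, ξ) := by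
    simp only [Ψ]
    have h4 : 0 ≤ t * (t * (τ * r) * I) + 1 / 2 * ((t * (τ * r)) ^ 2 * Q)
        - t * (τ * r) * f z (max ξ 0) * G.μ z := by linarith
    refine h4.trans (le_of_eq ?_)
    ring
  have h5 : Ψ (t, t * 0 + τ * r, ξ) < 0 := by
    refine hρ ?_
    have ht1 : |t - 1| ≤ δ := abs_le.2 ⟨by linarith [ht.1], by linarith [ht.2]⟩
    have hτr : |τ * r| = r := by rw [abs_mul, hτ, one_mul, abs_of_pos hr0]
    have hδρ2 : δ < ρ := by
      have : 0 ≤ δ * |u z| := by positivity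
      linarith
    have hξu : |ξ - u z| < ρ := by
      have e1 : |ξ - t * u z| ≤ 2 * r := by
        refine hξ.trans ?_
        rw [abs_mul, hτr, abs_of_pos ht0]
        exact mul_le_mul_of_nonneg_right ht2 hr0.le
      have e2 : |t * u z - u z| ≤ δ * |u z| := by
        have : t * u z - u z = (t - 1) * u z := by ring
        rw [this, abs_mul]
        exact mul_le_mul_of_nonneg_right ht1 (abs_nonneg _)
      have e3 := abs_sub_le ξ (t * u z) (u z)
      linarith
    rw [Prod.dist_eq, Prod.dist_eq, max_lt_iff, max_lt_iff, Real.dist_eq, Real.dist_eq,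
      Real.dist_eq]
    refine ⟨ht1.trans_lt hδρ2, ?_, hξu⟩
    simp only [mul_zero, zero_add, sub_zero, hτr]
    linarith
  exact absurd h3 (not_le.2 (mul_neg_of_pos_of_neg (mul_pos ht0 hr0) h5))

theorem equation_of_minimizer (R : G.Regular s h) (hh : Tendsto h cofinite atTop)
    (N : Superlinear f c) (hu : u ∈ G.nehariPos s h f)
    (hmin : ∀ v ∈ G.nehariPos s h f, G.energyPos s h f u ≤ G.energyPos s h f v) (z : V) :
    G.fracLaplacian s u z + h z * u z = f z (max (u z) 0) := by
  have h1 := R.sign_mul_nonneg_of_minimizer hh N hu hmin z (τ := 1) (by simp)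
  have h2 := R.sign_mul_nonneg_of_minimizer hh N hu hmin z (τ := -1) (by simp)
  linarith

/-- Minimum principle: at a negative minimum the fractional Laplacian is nonpositive and $hu<0$,
whereas the right side is $f(z,0)=0$. -/
theorem nonneg_of_equation (R : G.Regular s h) (N : Superlinear f c) (hu : u ∈ G.energySpace s h)
    (heq : ∀ z, G.fracLaplacian s u z + h z * u z = f z (max (u z) 0)) (x : V) : 0 ≤ u x := by
  by_contra! hx
  obtain ⟨μ₀, hμ0, hμ⟩ := R.μ_lower
  -- Square summability and $\inf\mu>0$ make the sublevel set finite, so the minimum is attained.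
  have hfin : {y | u y ≤ u x}.Finite := by
    have h1 := (R.summable_sq hu).tendsto_cofinite_zero.eventually_lt_const
      (show (0 : ℝ) < u x ^ 2 * μ₀ by have := hx.ne; positivity)
    refine (eventually_cofinite.1 h1).subset fun y hy => not_lt.2 ?_
    have hy' : u y ≤ u x := hy
    exact mul_le_mul (by nlinarith) (hμ y) hμ0.le (sq_nonneg _)
  obtain ⟨z, hz, hzmin⟩ := Set.exists_min_image _ u hfin ⟨x, le_refl (u x)⟩
  have hz' : u z ≤ u x := hz
  have hle : ∀ y, u z ≤ u y := fun y => by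
    rcases le_total (u y) (u x) with hy | hy
    · exact hzmin y hy
    · exact hz'.trans hy
  have h1 : G.fracLaplacian s u z ≤ 0 := by
    refine div_nonpos_of_nonpos_of_nonneg (tsum_nonpos fun y => ?_) (G.μ_pos z).le
    exact mul_nonpos_of_nonneg_of_nonpos (R.kernel_nonneg z y) (sub_nonpos.2 (hle y))
  have hz0 : u z < 0 := hz'.trans_lt hx
  have h2 := mul_neg_of_pos_of_neg (R.h_pos z) hz0
  have h3 := heq z
  rw [max_eq_right hz0.le, N.zero] at h3
  linarith

theorem pos_of_equation (R : G.Regular s h) (N : Superlinear f c) (hconn : G.graph.Connected)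
    (hadj : ∀ x y, G.graph.Adj x y → 0 < G.kernel s x y) (hu : u ∈ G.energySpace s h) (h0 : u ≠ 0)
    (heq : ∀ z, G.fracLaplacian s u z + h z * u z = f z (max (u z) 0)) (x : V) : 0 < u x := by
  have hnn := R.nonneg_of_equation N hu heq
  by_contra hx
  have hx0 : u x = 0 := le_antisymm (not_lt.1 hx) (hnn x)
  -- At a zero, $\sum_yW_s(z,y)u(y)=0$ has nonnegative terms, so `u` vanishes at all neighbours.
  have hstep : ∀ z y, G.graph.Adj z y → u z = 0 → u y = 0 := fun z y hzy hz => by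
    have h1 := heq z
    rw [hz, mul_zero, add_zero, max_self, N.zero, fracLaplacian,
      div_eq_zero_iff, or_iff_left (G.μ_pos z).ne'] at h1
    have h2 := (R.summable_kernel_mul_sub (R.bounded_of_mem_energySpace hu) z).hasSum
    rw [h1] at h2
    have h3 := h2.neg
    rw [neg_zero, hasSum_zero_iff_of_nonneg (fun w => by
      have := mul_nonneg (R.kernel_nonneg z w) (hnn w)
      simp only [hz]; linarith)] at h3
    have h4 := congrFun h3 y
    simp only [hz, zero_sub, mul_neg, neg_neg, Pi.zero_apply] at h4
    exact (mul_eq_zero.1 h4).resolve_left (hadj z y hzy).ne'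
  refine h0 (funext fun y => ?_)
  obtain ⟨p⟩ := hconn.preconnected x y
  induction p with
  | nil => exact hx0
  | cons hxy _ ih => exact ih (by rw [hstep _ _ hxy hx0]; exact lt_irrefl 0) (hstep _ _ hxy hx0)

/-- Pointwise solutions of finite energy are weak solutions. -/
theorem isWeakSolution_of_equation (R : G.Regular s h) (hu : u ∈ G.Hs s h)
    (hbound : ∃ C, ∀ x, |f x (u x)| ≤ C * |u x|) (heq : G.IsPointwiseSolution s h f u) :
    G.IsWeakSolution s h f u := by
  classical
  have hu' := R.mem_energySpace hu
  obtain ⟨C, hC⟩ := hbound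
  obtain ⟨h₀, h0, hl⟩ := R.h_lower
  have hsq : ∀ x, 0 < √(h x * G.μ x) := fun x => Real.sqrt_pos.2 (mul_pos (R.h_pos x) (G.μ_pos x))
  -- The $\ell^2$ vector representing $\varphi\mapsto\int f(x,u)\varphi\,d\mu$; the division cancels
  -- the weight of the vertex coordinates.
  let g : (V × V) ⊕ V → ℝ := Sum.elim 0 fun x => f x (u x) * G.μ x / √(h x * G.μ x)
  have hg : Memℓp g 2 := by
    rw [memℓp_two_iff]
    refine (HasSum.sum (a := 0) (f := fun i => g i ^ 2) ?_ (Summable.hasSum ?_)).summable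
    · exact hasSum_of_eq hasSum_zero (fun p => by simp [g]) rfl
    · refine Summable.of_nonneg_of_le (fun x => sq_nonneg _) (fun x => ?_)
        ((R.summable_sq hu').mul_left (C ^ 2 / h₀))
      have h1 : f x (u x) ^ 2 ≤ C ^ 2 * u x ^ 2 := by
        rw [← sq_abs, ← sq_abs (u x), ← mul_pow]
        exact pow_le_pow_left₀ (abs_nonneg _) (hC x) 2
      simp only [Function.comp, g, Sum.elim_inr]
      rw [div_pow, Real.sq_sqrt (mul_pos (R.h_pos x) (G.μ_pos x)).le,
        div_le_iff₀ (mul_pos (R.h_pos x) (G.μ_pos x))]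
      have h2 : C ^ 2 * u x ^ 2 * G.μ x ^ 2 ≤ C ^ 2 * u x ^ 2 * G.μ x ^ 2 * (h x / h₀) :=
        le_mul_of_one_le_right (by positivity) ((one_le_div h0).2 (hl x))
      have h3 := mul_le_mul_of_nonneg_right h1 (sq_nonneg (G.μ x))
      calc (f x (u x) * G.μ x) ^ 2 = f x (u x) ^ 2 * G.μ x ^ 2 := by ring
        _ ≤ C ^ 2 * u x ^ 2 * G.μ x ^ 2 * (h x / h₀) := h3.trans h2
        _ = _ := by ring
  let γ : EnergySeq V := ⟨g, hg⟩
  have hγ : ∀ φ ∈ G.energySpace s h, HasSum (fun x => f x (u x) * φ x * G.μ x)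
      (inner ℝ γ (G.energyVec s h φ)) := fun φ hφ => by
    have h1 := hasSum_lp_inner γ (G.energyVec s h φ)
    rw [← Sum.inr_injective.hasSum_iff] at h1
    · refine hasSum_of_eq h1 (fun x => ?_) rfl
      simp only [Function.comp, energyVec_inr hφ]
      have : γ (Sum.inr x) = f x (u x) * G.μ x / √(h x * G.μ x) := rfl
      rw [this]
      rw [← mul_assoc, div_mul_cancel₀ _ (hsq x).ne']
      ring
    · rintro (p | x) hi
      · have : γ (Sum.inl p) = 0 := rfl
        rw [this, zero_mul]
      · exact absurd ⟨x, rfl⟩ hi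
  refine ⟨hu, fun φ hφ => ?_⟩
  have hφ' := R.mem_energySpace hφ
  have h1 := R.hasSum_inner hu' hφ'
  have h2 := hγ φ hφ'
  refine ⟨h1.summable, h2.summable, ?_⟩
  rw [integral, integral, h1.tsum_eq, h2.tsum_eq, ← sub_eq_zero, ← inner_sub_left]
  -- Orthogonality to the image of $\delta_z$ is the pointwise equation at $z$; it extends to the
  -- closure of the span.
  have hperp : G.energyVec s h u - γ ∈ (G.testSpan s h)ᗮ := by
    rw [Submodule.mem_orthogonal]
    intro w hw
    induction hw using Submodule.span_induction with
    | mem w hw =>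
      obtain ⟨z, rfl⟩ := hw
      have hz := R.single_mem (h := h) z
      have h3 : inner ℝ γ (G.energyVec s h (Pi.single z 1)) = f z (u z) * G.μ z := by
        refine (hγ _ hz).unique (hasSum_of_eq (hasSum_single z fun x hx => ?_) (fun x => rfl) ?_)
        · simp [hx]
        · simp
      rw [inner_sub_right, real_inner_comm, real_inner_comm γ]
      rw [h3, R.inner_single hu' z, heq z, sub_self]
    | zero => exact inner_zero_left _
    | add a b _ _ ha hb => rw [inner_add_left, ha, hb, add_zero]
    | smul r a _ ha => rw [real_inner_smul_left, ha, mul_zero]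
  have h3 := (R.mem_Hs_iff.1 hφ).2
  rw [← Submodule.orthogonal_orthogonal_eq_closure] at h3
  exact (Submodule.mem_orthogonal _ _).1 h3 _ hperp

end WeightedGraph.Regular

/-! ### Reflection, exchanging positive and negative solutions. -/

section Reflection

variable {f : V → ℝ → ℝ} {c : ℝ}

theorem max_neg_zero (y : ℝ) : max (-y) 0 = -min y 0 := by
  rw [← max_neg_neg, neg_zero]

theorem min_neg_zero (y : ℝ) : min (-y) 0 = -max y 0 := by
  rw [← min_neg_neg, neg_zero]

/-- The reflected nonlinearity `-f(x,-y)`. -/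
def reflect (f : V → ℝ → ℝ) (x : V) (y : ℝ) : ℝ := -f x (-y)

theorem primitive_reflect (f : V → ℝ → ℝ) (x : V) (y : ℝ) :
    primitive (reflect f) x y = primitive f x (-y) := by
  simp only [primitive, reflect, intervalIntegral.integral_neg]
  rw [intervalIntegral.integral_comp_neg fun t => f x t, neg_zero,
    intervalIntegral.integral_symm, neg_neg]

theorem superlinear_of_hypotheses
    (hF1 : ∀ x, Continuous (f x) ∧ f x 0 = 0)
    (hF2 : ∀ M : ℝ, 0 < M → ∃ C : ℝ, ∀ x, ∀ y ∈ Set.Icc (-M) M, |f x y| ≤ C)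
    (hF3 : ∃ α : ℝ, 2 < α ∧ ∀ x, ∀ y : ℝ, y ≠ 0 →
      0 < α * primitive f x y ∧ α * primitive f x y ≤ y * f x y)
    (hF4 : ∀ᶠ y in 𝓝[≠] (0 : ℝ), ∀ x, f x y / y ≤ c)
    (hF5 : ∀ x, StrictMonoOn (fun y => f x y / |y|) (Set.Ioi 0)) : Superlinear f c where
  continuous x := (hF1 x).1
  zero x := (hF1 x).2
  bounded M hM := by
    obtain ⟨C, hC⟩ := hF2 M hM
    exact ⟨C, fun x y hy hyM => hC x y ⟨by linarith, hyM⟩⟩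
  ambrosetti_rabinowitz := by
    obtain ⟨α, hα2, hα⟩ := hF3
    exact ⟨α, hα2, fun x y hy => hα x y hy.ne'⟩
  small := by
    obtain ⟨η, hη, h⟩ := Metric.eventually_nhds_iff.1 (eventually_nhdsWithin_iff.1 hF4)
    refine ⟨η, hη, fun x y hy hyη => ?_⟩
    have := h (y := y) (by rwa [Real.dist_eq, sub_zero, abs_of_pos hy]) hy.ne' x
    rwa [div_le_iff₀ hy] at this
  strictMono x a b ha hab := by
    have hb := ha.trans hab
    have := hF5 x ha hb hab
    simp only [abs_of_pos ha, abs_of_pos hb] at this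
    rwa [div_lt_div_iff₀ ha hb] at this

/-- (F5) on the negative half-line carries over since $y\mapsto-y$ and the outer sign each reverse
the order. -/
theorem superlinear_reflect
    (hF1 : ∀ x, Continuous (f x) ∧ f x 0 = 0)
    (hF2 : ∀ M : ℝ, 0 < M → ∃ C : ℝ, ∀ x, ∀ y ∈ Set.Icc (-M) M, |f x y| ≤ C)
    (hF3 : ∃ α : ℝ, 2 < α ∧ ∀ x, ∀ y : ℝ, y ≠ 0 →
      0 < α * primitive f x y ∧ α * primitive f x y ≤ y * f x y)
    (hF4 : ∀ᶠ y in 𝓝[≠] (0 : ℝ), ∀ x, f x y / y ≤ c)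
    (hF5 : ∀ x, StrictMonoOn (fun y => f x y / |y|) (Set.Iio 0)) :
    Superlinear (reflect f) c := by
  refine superlinear_of_hypotheses (fun x => ⟨((hF1 x).1.comp continuous_neg).neg, ?_⟩)
    (fun M hM => ?_) ?_ ?_ fun x a ha b hb hab => ?_
  · simp [reflect, (hF1 x).2]
  · obtain ⟨C, hC⟩ := hF2 M hM
    refine ⟨C, fun x y hy => ?_⟩
    rw [reflect, abs_neg]
    exact hC x (-y) ⟨neg_le_neg hy.2, by linarith [hy.1]⟩
  · obtain ⟨α, hα2, hα⟩ := hF3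
    refine ⟨α, hα2, fun x y hy => ?_⟩
    rw [primitive_reflect, reflect, mul_neg, ← neg_mul]
    exact hα x (-y) (neg_ne_zero.2 hy)
  · rw [eventually_nhdsWithin_iff] at hF4 ⊢
    have h1 : Tendsto (fun y : ℝ => -y) (𝓝 0) (𝓝 0) := by
      simpa using (continuous_neg (G := ℝ)).tendsto 0
    refine (h1.eventually hF4).mono fun y hy hy0 x => ?_
    rw [reflect, neg_div, ← div_neg]
    exact hy (neg_ne_zero.2 hy0) x
  · have ha' : -a ∈ Set.Iio (0 : ℝ) := Set.mem_Iio.2 (neg_neg_of_pos ha)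
    have hb' : -b ∈ Set.Iio (0 : ℝ) := Set.mem_Iio.2 (neg_neg_of_pos hb)
    have := hF5 x hb' ha' (neg_lt_neg hab)
    simp only [abs_neg] at this
    simp only [reflect, neg_div]
    exact neg_lt_neg this

end Reflection

/-! ### Assembly of the two ground states. -/

namespace WeightedGraph

variable {G : WeightedGraph V} {s : ℝ} {h : V → ℝ} {f : V → ℝ → ℝ} {c : ℝ}

theorem fracLaplacian_neg (G : WeightedGraph V) (s : ℝ) (u : V → ℝ) (x : V) :
    G.fracLaplacian s (-u) x = -G.fracLaplacian s u x := by
  rw [fracLaplacian, fracLaplacian, ← neg_div, ← tsum_neg]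
  congr 1
  exact tsum_congr fun y => by simp only [Pi.neg_apply]; ring

namespace Regular

theorem neg_mem_Hs (R : G.Regular s h) {u : V → ℝ} (hu : u ∈ G.Hs s h) : -u ∈ G.Hs s h := by
  simpa using R.smul_mem_Hs (-1) hu

theorem normSq_neg (R : G.Regular s h) {u : V → ℝ} (hu : u ∈ G.Hs s h) :
    G.normSq s h (-u) = G.normSq s h u := by
  have hE := R.mem_energySpace hu
  have h1 := R.norm_energyVec_smul (-1) hu
  rw [R.normSq_eq hE, R.normSq_eq (neg_mem hE)]
  simpa using h1

theorem neg_mem_nehariPos_reflect (R : G.Regular s h) {u : V → ℝ} (hu : u ∈ G.nehariNeg s h f) :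
    -u ∈ G.nehariPos s h (reflect f) := by
  obtain ⟨hu, h0, heq⟩ := hu
  refine ⟨R.neg_mem_Hs hu, neg_ne_zero.2 h0, ?_⟩
  rw [R.normSq_neg hu, heq]
  congr 1
  ext x
  rw [Pi.neg_apply, max_neg_zero, reflect, neg_neg, neg_mul_neg]

theorem neg_mem_nehariNeg (R : G.Regular s h) {u : V → ℝ}
    (hu : u ∈ G.nehariPos s h (reflect f)) : -u ∈ G.nehariNeg s h f := by
  obtain ⟨hu, h0, heq⟩ := hu
  refine ⟨R.neg_mem_Hs hu, neg_ne_zero.2 h0, ?_⟩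
  rw [R.normSq_neg hu, heq]
  congr 1
  ext x
  rw [Pi.neg_apply, min_neg_zero, reflect, neg_mul, mul_neg]

theorem energyNeg_eq (R : G.Regular s h) {u : V → ℝ} (hu : u ∈ G.Hs s h) :
    G.energyNeg s h f u = G.energyPos s h (reflect f) (-u) := by
  rw [energyNeg, energyPos, R.normSq_neg hu]
  congr 2
  ext x
  rw [Pi.neg_apply, max_neg_zero, primitive_reflect, neg_neg]

/-- Existence of a positive minimizer of the energy on the Nehari manifold; it solves the
equation pointwise, and the nonlinearity grows at most linearly along it. -/
theorem exists_positive_ground_state [Countable V] [Nonempty V] (R : G.Regular s h)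
    (hconn : G.graph.Connected) (hadj : ∀ x y, G.graph.Adj x y → 0 < G.kernel s x y)
    (hh : Tendsto h cofinite atTop) (N : Superlinear f c) (hc : c < G.lambdaOne s h) :
    ∃ u ∈ G.nehariPos s h f, (∀ v ∈ G.nehariPos s h f, G.energyPos s h f u ≤ G.energyPos s h f v) ∧
      (∀ x, 0 < u x) ∧ G.IsPointwiseSolution s h f u ∧ ∃ C, ∀ x, |f x (u x)| ≤ C * |u x| := by
  obtain ⟨u, hu, hmin⟩ := R.exists_minimizer hh N hc
  have heq := R.equation_of_minimizer hh N hu hmin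
  have hE := R.mem_energySpace hu.1
  have hpos := R.pos_of_equation N hconn hadj hE hu.2.1 heq
  refine ⟨u, hu, hmin, hpos, fun x => ?_, ?_⟩
  · rw [heq x, max_eq_left (hpos x).le]
  · obtain ⟨M, hM⟩ := R.bounded_of_mem_energySpace hE
    obtain ⟨C, -, hC⟩ := N.exists_linear_bound M
    refine ⟨C, fun x => ?_⟩
    rw [abs_of_nonneg (N.nonneg x (hpos x).le), abs_of_pos (hpos x)]
    exact hC x _ (hpos x).le ((le_abs_self _).trans (hM x))

end Regular
end WeightedGraph
end FracGraph
end

theorem theorem2p5 {V : Type*} [Countable V] [Infinite V] (G : FracGraph.WeightedGraph V)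
    (hconn : G.graph.Connected) (hlf : G.IsLocallyFinite) (hsc : G.StochasticallyComplete)
    (s : ℝ) (hs0 : 0 < s) (hs1 : s < 1)
    (hμ : ∃ μ₀ : ℝ, 0 < μ₀ ∧ ∀ x, μ₀ ≤ G.μ x)
    (h : V → ℝ)
    (hh1 : ∃ h₀ : ℝ, 0 < h₀ ∧ ∀ x, h₀ ≤ h x)
    (hh2 : ∀ x₀ : V, Tendsto h (comap (fun x => G.graph.dist x x₀) atTop) atTop)
    (f : V → ℝ → ℝ)
    (hF1 : ∀ x, Continuous (f x) ∧ f x 0 = 0)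
    (hF2 : ∀ M : ℝ, 0 < M → ∃ C : ℝ, ∀ x, ∀ y ∈ Set.Icc (-M) M, |f x y| ≤ C)
    (hF3 : ∃ α : ℝ, 2 < α ∧ ∀ x, ∀ y : ℝ, y ≠ 0 →
      0 < α * FracGraph.primitive f x y ∧ α * FracGraph.primitive f x y ≤ y * f x y)
    -- limsup of `f x y / y` as `y → 0` is less than `λ₁`, uniformly in `x`
    (hF4 : ∃ c : ℝ, c < G.lambdaOne s h ∧ ∀ᶠ y in 𝓝[≠] (0 : ℝ), ∀ x, f x y / y ≤ c)
    (hF5 : ∀ x, StrictMonoOn (fun y => f x y / |y|) (Set.Iio 0) ∧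
      StrictMonoOn (fun y => f x y / |y|) (Set.Ioi 0)) :
    (∃ u : V → ℝ, G.IsWeakSolution s h f u ∧ G.IsPointwiseSolution s h f u ∧
      (∀ x, 0 < u x) ∧
      u ∈ G.nehariPos s h f ∧
      ∀ v ∈ G.nehariPos s h f, G.energyPos s h f u ≤ G.energyPos s h f v) ∧
    (∃ u : V → ℝ, G.IsWeakSolution s h f u ∧ G.IsPointwiseSolution s h f u ∧
      (∀ x, u x < 0) ∧
      u ∈ G.nehariNeg s h f ∧
      ∀ v ∈ G.nehariNeg s h f, G.energyNeg s h f u ≤ G.energyNeg s h f v) := by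
  have R : G.Regular s h :=
    ⟨G.kernel_nonneg hs0 hs1, G.kernel_symm s, hsc.summable_kernel hlf hs0 hs1, hμ, hh1⟩
  have hadj : ∀ x y, G.graph.Adj x y → 0 < G.kernel s x y := fun _ _ hxy =>
    hsc.kernel_pos_of_adj hlf hs0 hs1 hxy
  -- Balls are finite, so leaving every finite set forces the distance, and hence `h`, to infinity.
  have hh : Tendsto h cofinite atTop := by
    have x₀ : V := Classical.arbitrary V
    exact (hh2 x₀).comp (tendsto_iff_comap.1 (hlf.tendsto_dist_cofinite hconn x₀))
  obtain ⟨c, hc, hF4⟩ := hF4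
  constructor
  · obtain ⟨u, hu, hmin, hpos, heq, hbound⟩ := R.exists_positive_ground_state hconn hadj hh
      (FracGraph.superlinear_of_hypotheses hF1 hF2 hF3 hF4 fun x => (hF5 x).2) hc
    exact ⟨u, R.isWeakSolution_of_equation hu.1 hbound heq, heq, hpos, hu, hmin⟩
  · obtain ⟨u, hu, hmin, hpos, heq, C, hC⟩ := R.exists_positive_ground_state hconn hadj hh
      (FracGraph.superlinear_reflect hF1 hF2 hF3 hF4 fun x => (hF5 x).1) hc
    have heq' : G.IsPointwiseSolution s h f (-u) := fun x => by
      have h1 := heq x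
      rw [FracGraph.reflect] at h1
      rw [FracGraph.WeightedGraph.fracLaplacian_neg, Pi.neg_apply]
      linarith
    have hbound : ∃ C, ∀ x, |f x ((-u) x)| ≤ C * |(-u) x| := ⟨C, fun x => by
      have h1 := hC x
      rw [FracGraph.reflect, abs_neg] at h1
      rwa [Pi.neg_apply, abs_neg]⟩
    refine ⟨-u, R.isWeakSolution_of_equation (R.neg_mem_Hs hu.1) hbound heq', heq',
      fun x => neg_neg_of_pos (hpos x), R.neg_mem_nehariNeg hu, fun v hv => ?_⟩
    rw [R.energyNeg_eq (R.neg_mem_Hs hu.1), R.energyNeg_eq hv.1, neg_neg]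
    exact hmin _ (R.neg_mem_nehariPos_reflect hv)
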